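/- Let $n\ge 3$ and let $(M,g)$ be a connected smooth Riemannian manifold of dimension $n$, with Levi-Civita connection $\nabla$, curvature tensor $R(X,Y)=[\nabla_X,\nabla_Y]-\nabla_{[X,Y]}$, Jacobi operators $\lambda_x\colon T_pM\to T_pM$, $\lambda_x(y)=R(y,x)x$ for $x\in T_pM$, Ricci tensor $\mathrm{Ric}(x,z)=\operatorname{trace}(y\mapsto R(y,x)z)$, and Ricci operator $\rho$ defined by $g(\rho(x),z)=\mathrm{Ric}(x,z)$. Assume that (i) $(M,g)$ is locally conformally flat: every point of $M$ has an open neighbourhood $U$ with a smooth function $f\colon U\to\mathbb R$ such that the metric $e^{2f}g$ is flat (has vanishing curvature tensor) on $U$; (ii) $(M,g)$ is a $\mathcal C$-space: for every geodesic $\gamma\colon J\to M$ on an open interval $J\subseteq\mathbb{R}$, the eigenvalues of $\lambda_{\dot\gamma(t)}$, counted with multiplicity, do not depend on $t\in J$. Then $(M,g)$ has constant Ricci eigenvalues: there are real numbers $r_1,\dots,r_n$ such that at every point $p\in M$ the eigenvalues of $\rho$ on $T_pM$, counted with multiplicity, are $r_1,\dots,r_n$. -/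

import Mathlib

set_option maxSynthPendingDepth 3

open scoped Manifold ContDiff Topology

noncomputable section

namespace CSpace

/-! ### Riemannian geometry of a field of bilinear forms on a vector space

`G : E → E →L[ℝ] E →L[ℝ] ℝ` plays the role of the components `g_{ij}` of a metric read in a chart.
All formulas are the classical coordinate formulas, written without indices. -/

section Local

variable {E : Type*} [NormedAddCommGroup E] [NormedSpace ℝ E]

/-- The Christoffel symbols of the first kind:
`christoffelLower G y v w z = (1/2) (∂_v G(w, z) + ∂_w G(v, z) - ∂_z G(v, w))`. -/
def christoffelLower (G : E → E →L[ℝ] E →L[ℝ] ℝ) (y : E) : E →L[ℝ] E →L[ℝ] E →L[ℝ] ℝ :=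
  (1 / 2 : ℝ) • (fderiv ℝ G y + (fderiv ℝ G y).flip -
    (ContinuousLinearMap.flipₗᵢ ℝ E E ℝ).toContinuousLinearEquiv.toContinuousLinearMap.comp
      (fderiv ℝ G y).flip)

theorem christoffelLower_apply (G : E → E →L[ℝ] E →L[ℝ] ℝ) (y v w z : E) :
    christoffelLower G y v w z =
      1 / 2 * (fderiv ℝ G y v w z + fderiv ℝ G y w v z - fderiv ℝ G y z v w) := by
  simp [christoffelLower]

/-- The Christoffel symbols (of the second kind) `Γ_y(v, w)` of the Levi-Civita connection of `G`:
`G_y(Γ_y(v, w), z) = (1/2) (∂_v G(w, z) + ∂_w G(v, z) - ∂_z G(v, w))` for all `z`, that is,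
`∇_v W = ∂_v W + Γ(v, W)`. -/
def christoffel (G : E → E →L[ℝ] E →L[ℝ] ℝ) (y : E) : E →L[ℝ] E →L[ℝ] E :=
  (ContinuousLinearMap.compL ℝ E (E →L[ℝ] ℝ) E (G y).inverse) ∘L christoffelLower G y

theorem christoffel_apply (G : E → E →L[ℝ] E →L[ℝ] ℝ) (y v w : E) :
    christoffel G y v w = (G y).inverse (christoffelLower G y v w) := rfl

/-- `v ↦ R(v, x) z` for the curvature tensor `R(X, Y) = [∇_X, ∇_Y] - ∇_{[X, Y]}` of the
Levi-Civita connection of `G` at `y`: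
`R(v, x) z = (∂_v Γ)(x, z) - (∂_x Γ)(v, z) + Γ(v, Γ(x, z)) - Γ(x, Γ(v, z))`. -/
def curvatureEnd (G : E → E →L[ℝ] E →L[ℝ] ℝ) (y x z : E) : E →ₗ[ℝ] E where
  toFun v :=
    fderiv ℝ (christoffel G) y v x z - fderiv ℝ (christoffel G) y x v z
      + christoffel G y v (christoffel G y x z) - christoffel G y x (christoffel G y v z)
  map_add' v w := by simp only [map_add, add_apply]; abel
  map_smul' c v := by
    simp only [map_smul, smul_apply, smul_sub, smul_add, RingHom.id_apply]

/-- The Ricci tensor of `G` at `y`: `Ric(x, z)` is the trace of `v ↦ R(v, x) z`. -/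
def ricciForm (G : E → E →L[ℝ] E →L[ℝ] ℝ) (y : E) : E →ₗ[ℝ] E →ₗ[ℝ] ℝ :=
  LinearMap.mk₂ ℝ (fun x z => LinearMap.trace ℝ E (curvatureEnd G y x z))
    (fun x x' z => by
      rw [← map_add]; congr 1; ext v; simp [curvatureEnd]; abel)
    (fun c x z => by
      rw [← map_smul]; congr 1; ext v; simp [curvatureEnd, smul_sub, smul_add])
    (fun x z z' => by
      rw [← map_add]; congr 1; ext v; simp [curvatureEnd]; abel)
    (fun c x z => by
      rw [← map_smul]; congr 1; ext v; simp [curvatureEnd, smul_sub, smul_add])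

end Local

/-! ### Smooth manifolds -/

variable {n : ℕ} {M : Type*} [TopologicalSpace M] [ChartedSpace (EuclideanSpace ℝ (Fin n)) M]

/-- A field of bilinear forms on the tangent spaces of `M`. -/
abbrev BilinField (n : ℕ) (M : Type*) [TopologicalSpace M]
    [ChartedSpace (EuclideanSpace ℝ (Fin n)) M] :=
  ∀ x : M, TangentSpace (𝓡 n) x →L[ℝ] TangentSpace (𝓡 n) x →L[ℝ] ℝ

/-- The field `h` of bilinear forms read in the chart `φ_p` around `p`: the pullback of `h` under
`φ_p⁻¹`, that is, `(y, v, w) ↦ h(dφ_p⁻¹ v, dφ_p⁻¹ w)` at the point `φ_p⁻¹(y)`. -/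
def inChart (h : BilinField n M) (p : M) (y : EuclideanSpace ℝ (Fin n)) :
    EuclideanSpace ℝ (Fin n) →L[ℝ] EuclideanSpace ℝ (Fin n) →L[ℝ] ℝ :=
  let B : EuclideanSpace ℝ (Fin n) →L[ℝ] EuclideanSpace ℝ (Fin n) →L[ℝ] ℝ :=
    h ((extChartAt (𝓡 n) p).symm y)
  let A : EuclideanSpace ℝ (Fin n) →L[ℝ] EuclideanSpace ℝ (Fin n) :=
    mfderiv (𝓡 n) (𝓡 n) (extChartAt (𝓡 n) p).symm y
  B.bilinearComp A A

theorem inChart_apply (h : BilinField n M) (p : M) (y v w : EuclideanSpace ℝ (Fin n)) :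
    inChart h p y v w =
      h ((extChartAt (𝓡 n) p).symm y)
        (mfderiv (𝓡 n) (𝓡 n) (extChartAt (𝓡 n) p).symm y v)
        (mfderiv (𝓡 n) (𝓡 n) (extChartAt (𝓡 n) p).symm y w) := rfl

/-- `v ↦ R(v, x) z` for the curvature tensor at `p` of the metric `h`. It is computed in the chart
`φ_p` around `p`, whose differential at `p` is the identification of `TangentSpace (𝓡 n) p` with
the model space `ℝⁿ` (it is the identity map). -/
def curvature (h : BilinField n M) (p : M) (x z : TangentSpace (𝓡 n) p) :
    TangentSpace (𝓡 n) p →ₗ[ℝ] TangentSpace (𝓡 n) p :=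
  curvatureEnd (inChart h p) (extChartAt (𝓡 n) p p) x z

/-- The Jacobi operator `λ_x(v) = R(v, x) x`. -/
def jacobiOperator (h : BilinField n M) (p : M) (x : TangentSpace (𝓡 n) p) :
    TangentSpace (𝓡 n) p →ₗ[ℝ] TangentSpace (𝓡 n) p :=
  curvature h p x x

/-- The Ricci tensor at `p`: `Ric(x, z) = trace (v ↦ R(v, x) z)`. -/
def ricci (h : BilinField n M) (p : M) :
    TangentSpace (𝓡 n) p →ₗ[ℝ] TangentSpace (𝓡 n) p →ₗ[ℝ] ℝ :=
  ricciForm (inChart h p) (extChartAt (𝓡 n) p p)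

theorem ricci_apply (h : BilinField n M) (p : M) (x z : TangentSpace (𝓡 n) p) :
    ricci h p x z = LinearMap.trace ℝ (TangentSpace (𝓡 n) p) (curvature h p x z) := rfl

instance (p : M) : FiniteDimensional ℝ (TangentSpace (𝓡 n) p) :=
  inferInstanceAs (FiniteDimensional ℝ (EuclideanSpace ℝ (Fin n)))

instance (p : M) : T2Space (TangentSpace (𝓡 n) p) :=
  inferInstanceAs (T2Space (EuclideanSpace ℝ (Fin n)))

/-- The Ricci operator `ρ` at `p`, with `h(ρ x, z) = Ric(x, z)` for all `z`. -/
def ricciOperator (h : BilinField n M) (p : M) :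
    TangentSpace (𝓡 n) p →ₗ[ℝ] TangentSpace (𝓡 n) p :=
  (h p).inverse.toLinearMap ∘ₗ
    (LinearMap.toContinuousLinearMap (𝕜 := ℝ) (E := TangentSpace (𝓡 n) p) (F' := ℝ)).toLinearMap
      ∘ₗ ricci h p

theorem isInvertible_metric [IsManifold (𝓡 n) ∞ M] (g : Bundle.ContMDiffRiemannianMetric (𝓡 n) ∞
      (EuclideanSpace ℝ (Fin n)) (fun x : M => TangentSpace (𝓡 n) x)) (p : M) : (g.inner p).IsInvertible := by
  have hinj : Function.Injective
      ((LinearMap.toContinuousLinearMap (𝕜 := ℝ) (E := TangentSpace (𝓡 n) p)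
        (F' := ℝ)).symm.toLinearMap ∘ₗ (g.inner p).toLinearMap) := by
    rw [← LinearMap.ker_eq_bot, LinearMap.ker_eq_bot']
    intro v hv
    by_contra h
    have := g.pos p v h
    have h2 := congrArg (fun L => L v) hv
    simp at h2
    linarith
  have hfr : Module.finrank ℝ (TangentSpace (𝓡 n) p) =
      Module.finrank ℝ (TangentSpace (𝓡 n) p →ₗ[ℝ] ℝ) := by
    exact (Subspace.dual_finrank_eq).symm
  have hbij : Function.Bijective (g.inner p) := by
    have hs := (LinearMap.injective_iff_surjective_of_finrank_eq_finrank hfr).1 hinj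
    refine ⟨fun a b hab => hinj (by simp [hab]), fun y => ?_⟩
    obtain ⟨x, hx⟩ := hs (LinearMap.toContinuousLinearMap.symm y)
    exact ⟨x, LinearMap.toContinuousLinearMap.symm.injective hx⟩
  let F := EuclideanSpace ℝ (Fin n)
  let B : F →L[ℝ] F →L[ℝ] ℝ := g.inner p
  have : B.IsInvertible := by
    refine ⟨ContinuousLinearEquiv.ofBijective B
      (LinearMap.ker_eq_bot.2 hbij.1) (LinearMap.range_eq_top.2 hbij.2), ?_⟩
    ext; rfl
  exact this

theorem ricciOperator_spec [IsManifold (𝓡 n) ∞ M] (g : Bundle.ContMDiffRiemannianMetric (𝓡 n) ∞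
      (EuclideanSpace ℝ (Fin n)) (fun x : M => TangentSpace (𝓡 n) x)) (p : M) (x z : TangentSpace (𝓡 n) p) :
    g.inner p (ricciOperator g.inner p x) z = ricci g.inner p x z := by
  have := (isInvertible_metric g p).self_apply_inverse
    (LinearMap.toContinuousLinearMap (𝕜 := ℝ) (E := TangentSpace (𝓡 n) p) (F' := ℝ) (ricci g.inner p x))
  exact congrArg (fun L => L z) this

/-- The eigenvalues of a linear operator, repeated according to multiplicity. -/
def eigenvalues {V : Type*} [AddCommGroup V] [Module ℝ V] [FiniteDimensional ℝ V]
    (f : V →ₗ[ℝ] V) : Multiset ℝ :=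
  f.charpoly.roots

/-- The velocity vector `γ'(t)` of a curve. -/
def velocity (γ : ℝ → M) (t : ℝ) : TangentSpace (𝓡 n) (γ t) :=
  mfderiv 𝓘(ℝ, ℝ) (𝓡 n) γ t (1 : ℝ)

/-- `γ` is a geodesic of `h` on the set `J` of parameters: it is smooth on `J`, and at every `t ∈ J`
it satisfies the geodesic equation `u'' + Γ(u', u') = 0`, where `u` is the curve `γ` read in the
chart around `γ t`. -/
def IsGeodesicOn (h : BilinField n M) (γ : ℝ → M) (J : Set ℝ) : Prop :=
  ContMDiffOn 𝓘(ℝ, ℝ) (𝓡 n) ∞ γ J ∧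
    ∀ t ∈ J,
      let u : ℝ → EuclideanSpace ℝ (Fin n) := extChartAt (𝓡 n) (γ t) ∘ γ
      deriv (deriv u) t + christoffel (inChart h (γ t)) (u t) (deriv u t) (deriv u t) = 0

/-- `(M, h)` is a `𝒞`-space: along every geodesic, defined on an open interval `J`, the eigenvalues
of the Jacobi operators `λ_{γ'(t)}` do not depend on `t`. -/
def IsCSpace (h : BilinField n M) : Prop :=
  ∀ (γ : ℝ → M) (J : Set ℝ), IsOpen J → J.OrdConnected → IsGeodesicOn h γ J →
    ∀ s ∈ J, ∀ t ∈ J,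
      eigenvalues (jacobiOperator h (γ s) (velocity γ s)) =
        eigenvalues (jacobiOperator h (γ t) (velocity γ t))

/-- `h` is flat on `U`: its curvature tensor vanishes at every point of `U`. -/
def IsFlatOn (h : BilinField n M) (U : Set M) : Prop :=
  ∀ p ∈ U, ∀ v x z : TangentSpace (𝓡 n) p, curvature h p x z v = 0

/-- `(M, h)` is locally conformally flat: around every point there is a flat metric `e^{2f} h`
which is conformal to `h`. -/
def IsLocallyConformallyFlat (h : BilinField n M) : Prop :=
  ∀ p : M, ∃ U : Set M, IsOpen U ∧ p ∈ U ∧ ∃ f : M → ℝ,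
    ContMDiffOn (𝓡 n) 𝓘(ℝ, ℝ) ∞ f U ∧
      IsFlatOn (fun x => Real.exp (2 * f x) • h x) U

end CSpace

end

/-! The trace of the Jacobi operator of `x` is `Ric(x, x)`. Jacobi operators are symmetric for a
positive definite metric, so all their eigenvalues are real and sum to this trace
(`sum_eigenvalues_curvatureEnd`). On a 𝒞-space `Ric(γ', γ')` is therefore constant along geodesics.
Since a geodesic issues from every tangent vector, differentiating gives `(∇_v Ric)(v, v) = 0` for
all `v`: Ricci is a Killing tensor (`killing_of_geodesic`).

If `e^{2f} g` is flat, the curvature of `g` is built from `g` and `P = ∇df - df ⊗ df + |df|² g / 2`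
alone (`curvatureEnd_eq_of_flat`), and `Ric = (n - 2) P + (tr P) g`. Inserting this curvature into
the Ricci identity for `∇df` shows that `∇P` is totally symmetric (`schouten_codazzi`). Because `P`
is written explicitly through `f`, no separate argument is needed for `n = 3`.

With `t = d(tr P)`, polarizing the Killing equation against this symmetry gives `3(n - 2) ∇P(u, v,
w) + t(u) g(v, w) + t(v) g(u, w) + t(w) g(u, v) = 0`. Contracting `v` with `w` yields `4(n - 1) t(u)
= 0`, so `t = 0`, and `n > 2` then gives `∇P = 0`. Hence `ρ` is parallel: its coordinate derivative
is a commutator with the Christoffel symbols, which cannot change the characteristic polynomial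
(`charpoly_eq_of_parallel`). The eigenvalues are thus locally constant, and `M` is connected.

Curvature at a point is defined in that point's own chart, whereas the argument takes place in one
fixed chart. The two are compared by the naturality of Christoffel symbols and curvature under
changes of coordinates. -/

noncomputable section

namespace CSpace

/-! ### Levi-Civita calculus for a metric on an open subset of a vector space -/

section LocalMetric

variable {E : Type*} [NormedAddCommGroup E] [NormedSpace ℝ E]
  {F : Type*} [NormedAddCommGroup F] [NormedSpace ℝ F]

theorem contDiffOn_fderiv {f : E → F} {Ω : Set E} (hΩ : IsOpen Ω) (hf : ContDiffOn ℝ ∞ f Ω) :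
    ContDiffOn ℝ ∞ (fderiv ℝ f) Ω :=
  hf.fderiv_of_isOpen hΩ (by simp)

theorem hasFDerivAt_of_contDiffOn {f : E → F} {Ω : Set E} (hΩ : IsOpen Ω)
    (hf : ContDiffOn ℝ ∞ f Ω) {y : E} (hy : y ∈ Ω) : HasFDerivAt f (fderiv ℝ f y) y :=
  ((hf.contDiffAt (hΩ.mem_nhds hy)).differentiableAt (by simp)).hasFDerivAt

theorem fderiv_fderiv_comm {f : E → F} {Ω : Set E} (hΩ : IsOpen Ω) (hf : ContDiffOn ℝ ∞ f Ω)
    {y : E} (hy : y ∈ Ω) (u v : E) :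
    fderiv ℝ (fderiv ℝ f) y u v = fderiv ℝ (fderiv ℝ f) y v u :=
  (hf.contDiffAt (hΩ.mem_nhds hy)).isSymmSndFDerivAt
    (by simpa using WithTop.coe_le_coe.2 (le_top : (2 : ℕ∞) ≤ ⊤)) u v

theorem hasFDerivAt_apply_apply {F' : Type*} [NormedAddCommGroup F'] [NormedSpace ℝ F']
    {Γ : E → F →L[ℝ] F →L[ℝ] F'} {Γ' : E →L[ℝ] F →L[ℝ] F →L[ℝ] F'} {y : E}
    (h : HasFDerivAt Γ Γ' y) (v w : F) :
    HasFDerivAt (fun z => Γ z v w) ((Γ'.flip v).flip w) y :=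
  ((ContinuousLinearMap.apply ℝ F' w).comp
    (ContinuousLinearMap.apply ℝ (F →L[ℝ] F') v)).hasFDerivAt.comp y h

/-- `G` is a smooth field of nondegenerate symmetric bilinear forms on the open set `Ω`. -/
structure IsMetricOn (G : E → E →L[ℝ] E →L[ℝ] ℝ) (Ω : Set E) : Prop where
  isOpen : IsOpen Ω
  contDiffOn : ContDiffOn ℝ ∞ G Ω
  symm : ∀ y ∈ Ω, ∀ v w, G y v w = G y w v
  isInvertible : ∀ y ∈ Ω, (G y).IsInvertible

namespace IsMetricOn

variable {G : E → E →L[ℝ] E →L[ℝ] ℝ} {Ω : Set E} {y : E}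

theorem hasFDerivAt (hG : IsMetricOn G Ω) (hy : y ∈ Ω) : HasFDerivAt G (fderiv ℝ G y) y :=
  hasFDerivAt_of_contDiffOn hG.isOpen hG.contDiffOn hy

theorem eventually_mem (hG : IsMetricOn G Ω) (hy : y ∈ Ω) : ∀ᶠ z in 𝓝 y, z ∈ Ω :=
  hG.isOpen.mem_nhds hy

theorem fderiv_symm (hG : IsMetricOn G Ω) (hy : y ∈ Ω) (u v w : E) :
    fderiv ℝ G y u v w = fderiv ℝ G y u w v := by
  have h1 := (hasFDerivAt_apply_apply (hG.hasFDerivAt hy) v w).congr_of_eventuallyEq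
    (f₁ := fun z => G z w v) (by
      filter_upwards [hG.eventually_mem hy] with z hz using hG.symm z hz w v)
  exact congrArg (fun L => L u) (h1.unique (hasFDerivAt_apply_apply (hG.hasFDerivAt hy) w v))

theorem apply_inverse (hG : IsMetricOn G Ω) (hy : y ∈ Ω) (a : E →L[ℝ] ℝ) (z : E) :
    G y ((G y).inverse a) z = a z := by
  rw [(hG.isInvertible y hy).self_apply_inverse]

theorem eq_of_forall (hG : IsMetricOn G Ω) (hy : y ∈ Ω) {a b : E}
    (h : ∀ z, G y a z = G y b z) : a = b :=
  (hG.isInvertible y hy).injective (by ext z; exact h z)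

theorem apply_christoffel (hG : IsMetricOn G Ω) (hy : y ∈ Ω) (v w z : E) :
    G y (christoffel G y v w) z =
      1 / 2 * (fderiv ℝ G y v w z + fderiv ℝ G y w v z - fderiv ℝ G y z v w) := by
  rw [christoffel_apply, hG.apply_inverse hy, christoffelLower_apply]

theorem christoffel_comm (hG : IsMetricOn G Ω) (hy : y ∈ Ω) (v w : E) :
    christoffel G y v w = christoffel G y w v := by
  refine hG.eq_of_forall hy fun z => ?_
  rw [hG.apply_christoffel hy, hG.apply_christoffel hy, hG.fderiv_symm hy z v w]
  ring

/-- The Levi-Civita connection is compatible with the metric. -/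
theorem fderiv_eq (hG : IsMetricOn G Ω) (hy : y ∈ Ω) (u v w : E) :
    fderiv ℝ G y u v w = G y (christoffel G y u v) w + G y v (christoffel G y u w) := by
  rw [hG.symm y hy v, hG.apply_christoffel hy, hG.apply_christoffel hy, hG.fderiv_symm hy u w v,
    hG.fderiv_symm hy w u v, hG.fderiv_symm hy v u w]
  ring

/-- A symmetric connection which is compatible with the metric is the Levi-Civita connection. -/
theorem christoffel_unique (hG : IsMetricOn G Ω) (hy : y ∈ Ω) (B : E → E → E)
    (hB : ∀ v w, B v w = B w v)
    (hc : ∀ u v w, fderiv ℝ G y u v w = G y (B u v) w + G y v (B u w)) (v w : E) :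
    christoffel G y v w = B v w := by
  refine hG.eq_of_forall hy fun z => ?_
  rw [hG.apply_christoffel hy, hc, hc, hc, hB z v, hB z w, hB w v, hG.symm y hy (B v z) w,
    hG.symm y hy w]
  ring

variable [CompleteSpace E]

theorem contDiffOn_inverse (hG : IsMetricOn G Ω) :
    ContDiffOn ℝ ∞ (fun z => (G z).inverse) Ω := fun y hy =>
  ((hG.isInvertible y hy).contDiffAt_map_inverse.comp y
    (hG.contDiffOn.contDiffAt (hG.eventually_mem hy))).contDiffWithinAt

theorem contDiffOn_christoffel (hG : IsMetricOn G Ω) : ContDiffOn ℝ ∞ (christoffel G) Ω := by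
  have h1 := contDiffOn_fderiv hG.isOpen hG.contDiffOn
  have h2 : ContDiffOn ℝ ∞ (fun z => (fderiv ℝ G z).flip) Ω :=
    (ContinuousLinearMap.flipₗᵢ ℝ E E (E →L[ℝ] ℝ)).contDiff.comp_contDiffOn h1
  have h3 : ContDiffOn ℝ ∞ (christoffelLower G) Ω :=
    (contDiff_const_smul (1 / 2 : ℝ)).comp_contDiffOn
      ((h1.add h2).sub (contDiffOn_const.clm_comp h2))
  exact ((ContinuousLinearMap.compL ℝ E (E →L[ℝ] ℝ) E).contDiff.comp_contDiffOn
    hG.contDiffOn_inverse).clm_comp h3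

end IsMetricOn

end LocalMetric

/-! ### Naturality of the connection and curvature under local isometries -/

section Naturality

variable {E : Type*} [NormedAddCommGroup E] [NormedSpace ℝ E]

/-- `ψ` is smooth with invertible differentials on `Ω₁`, maps `Ω₁` to `Ω₂`, and pulls back `G₂` to
`G₁`. -/
structure IsLocalIsometryOn (G₁ G₂ : E → E →L[ℝ] E →L[ℝ] ℝ) (ψ : E → E) (Ω₁ Ω₂ : Set E) :
    Prop where
  contDiffOn : ContDiffOn ℝ ∞ ψ Ω₁
  mapsTo : Set.MapsTo ψ Ω₁ Ω₂
  isInvertible : ∀ y ∈ Ω₁, (fderiv ℝ ψ y).IsInvertible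
  pullback : ∀ y ∈ Ω₁, ∀ v w, G₁ y v w = G₂ (ψ y) (fderiv ℝ ψ y v) (fderiv ℝ ψ y w)

namespace IsLocalIsometryOn

variable {G₁ G₂ : E → E →L[ℝ] E →L[ℝ] ℝ} {ψ : E → E} {Ω₁ Ω₂ : Set E} {y : E}

/-- Solving for `christoffel G₁` gives a candidate connection that is symmetric because `D²ψ` is,
and metric by differentiating the pullback identity. Uniqueness of the Levi-Civita connection does
the rest. -/
theorem fderiv_christoffel (h : IsLocalIsometryOn G₁ G₂ ψ Ω₁ Ω₂) (h₁ : IsMetricOn G₁ Ω₁)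
    (h₂ : IsMetricOn G₂ Ω₂) (hy : y ∈ Ω₁) (v w : E) :
    fderiv ℝ ψ y (christoffel G₁ y v w) =
      christoffel G₂ (ψ y) (fderiv ℝ ψ y v) (fderiv ℝ ψ y w) +
        fderiv ℝ (fderiv ℝ ψ) y v w := by
  have hψ := hasFDerivAt_of_contDiffOn h₁.isOpen h.contDiffOn hy
  have hψ' := hasFDerivAt_of_contDiffOn h₁.isOpen (contDiffOn_fderiv h₁.isOpen h.contDiffOn) hy
  have hinv : ∀ a, fderiv ℝ ψ y ((fderiv ℝ ψ y).inverse a) = a := fun a =>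
    (h.isInvertible y hy).self_apply_inverse a
  have key := h₁.christoffel_unique hy (fun v w => (fderiv ℝ ψ y).inverse
    (christoffel G₂ (ψ y) (fderiv ℝ ψ y v) (fderiv ℝ ψ y w) + fderiv ℝ (fderiv ℝ ψ) y v w))
    (fun v w => by
      rw [h₂.christoffel_comm (h.mapsTo hy), fderiv_fderiv_comm h₁.isOpen h.contDiffOn hy])
    (fun u v w => by
      rw [h.pullback y hy, h.pullback y hy, hinv, hinv]
      have e1 := hasFDerivAt_apply_apply (h₁.hasFDerivAt hy) v w
      have e2 := (((h₂.hasFDerivAt (h.mapsTo hy)).comp y hψ).clm_apply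
        (hψ'.clm_apply (hasFDerivAt_const v y))).clm_apply (hψ'.clm_apply (hasFDerivAt_const w y))
      have e3 := e1.unique (e2.congr_of_eventuallyEq (by
        filter_upwards [h₁.eventually_mem hy] with z hz using h.pullback z hz v w))
      have e4 := congrArg (fun L => L u) e3
      simp at e4
      rw [e4, h₂.fderiv_eq (h.mapsTo hy)]
      simp only [map_add, add_apply]
      ring) v w
  rw [key, hinv]

theorem fderiv_curvatureEnd [CompleteSpace E] (h : IsLocalIsometryOn G₁ G₂ ψ Ω₁ Ω₂)
    (h₁ : IsMetricOn G₁ Ω₁) (h₂ : IsMetricOn G₂ Ω₂) (hy : y ∈ Ω₁) (x z v : E) :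
    fderiv ℝ ψ y (curvatureEnd G₁ y x z v) =
      curvatureEnd G₂ (ψ y) (fderiv ℝ ψ y x) (fderiv ℝ ψ y z) (fderiv ℝ ψ y v) := by
  have hs' := contDiffOn_fderiv h₁.isOpen h.contDiffOn
  have hs'' := contDiffOn_fderiv h₁.isOpen hs'
  have hψ := hasFDerivAt_of_contDiffOn h₁.isOpen h.contDiffOn hy
  have hψ' := hasFDerivAt_of_contDiffOn h₁.isOpen hs' hy
  have hψ'' := hasFDerivAt_of_contDiffOn h₁.isOpen hs'' hy
  have hΓ₁ := hasFDerivAt_of_contDiffOn h₁.isOpen h₁.contDiffOn_christoffel hy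
  have hΓ₂ := hasFDerivAt_of_contDiffOn h₂.isOpen h₂.contDiffOn_christoffel (h.mapsTo hy)
  -- The transformation law of the Christoffel symbols, differentiated in the direction `u`. In the
  -- curvature the `D³ψ` terms cancel by symmetry, and the `D²ψ` terms cancel against those from the
  -- quadratic part.
  have key : ∀ u v w : E, fderiv ℝ ψ y (fderiv ℝ (christoffel G₁) y u v w) =
      fderiv ℝ (christoffel G₂) (ψ y) (fderiv ℝ ψ y u) (fderiv ℝ ψ y v) (fderiv ℝ ψ y w)
      + christoffel G₂ (ψ y) (fderiv ℝ (fderiv ℝ ψ) y u v) (fderiv ℝ ψ y w)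
      + christoffel G₂ (ψ y) (fderiv ℝ ψ y v) (fderiv ℝ (fderiv ℝ ψ) y u w)
      + fderiv ℝ (fderiv ℝ (fderiv ℝ ψ)) y u v w
      - fderiv ℝ (fderiv ℝ ψ) y u (christoffel G₁ y v w) := by
    intro u v w
    have e1 := hψ'.clm_apply (hasFDerivAt_apply_apply hΓ₁ v w)
    have e2 := (((hΓ₂.comp y hψ).clm_apply
        (hψ'.clm_apply (hasFDerivAt_const v y))).clm_apply
          (hψ'.clm_apply (hasFDerivAt_const w y))).add (hasFDerivAt_apply_apply hψ'' v w)
    have e3 := e1.unique (e2.congr_of_eventuallyEq (by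
        filter_upwards [h₁.eventually_mem hy] with z hz using
          h.fderiv_christoffel h₁ h₂ hz v w))
    have e4 := congrArg (fun L => L u) e3
    simp at e4
    rw [eq_sub_iff_add_eq, e4]
    abel
  have hΓ := fun v w => h.fderiv_christoffel h₁ h₂ hy v w
  have hc := fun v w => fderiv_fderiv_comm h₁.isOpen h.contDiffOn hy v w
  simp only [curvatureEnd, LinearMap.coe_mk, AddHom.coe_mk, map_add, map_sub, key, hΓ]
  rw [fderiv_fderiv_comm h₁.isOpen hs' hy x v, hc x v]
  abel

end IsLocalIsometryOn

end Naturality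

/-! ### Conformal change of metric and the Schouten tensor -/

section Conformal

variable {E : Type*} [NormedAddCommGroup E] [NormedSpace ℝ E]

/-- The conformal metric `e^{2f} G`. -/
def conformalMetric (f : E → ℝ) (G : E → E →L[ℝ] E →L[ℝ] ℝ) (y : E) : E →L[ℝ] E →L[ℝ] ℝ :=
  Real.exp (2 * f y) • G y

/-- The gradient of `f` with respect to `G`. -/
def gradG (f : E → ℝ) (G : E → E →L[ℝ] E →L[ℝ] ℝ) (y : E) : E :=
  (G y).inverse (fderiv ℝ f y)

/-- The Hessian `∇df` of `f` with respect to `G`. -/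
def hessG (f : E → ℝ) (G : E → E →L[ℝ] E →L[ℝ] ℝ) (y v w : E) : ℝ :=
  fderiv ℝ (fderiv ℝ f) y v w - fderiv ℝ f y (christoffel G y v w)

/-- The covariant derivative of the gradient of `f`. -/
def covGradG (f : E → ℝ) (G : E → E →L[ℝ] E →L[ℝ] ℝ) (y v : E) : E :=
  fderiv ℝ (gradG f G) y v + christoffel G y v (gradG f G y)

/-- The bilinear form `∇df - df ⊗ df + |df|² G / 2`. It is the Schouten tensor of `G` when
`e^{2f} G` is flat. -/
def schouten (f : E → ℝ) (G : E → E →L[ℝ] E →L[ℝ] ℝ) (y : E) : E →L[ℝ] E →L[ℝ] ℝ :=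
  fderiv ℝ (fderiv ℝ f) y - (ContinuousLinearMap.compL ℝ E E ℝ (fderiv ℝ f y)) ∘L christoffel G y
    - (fderiv ℝ f y).smulRight (fderiv ℝ f y)
    + ((1 / 2 : ℝ) * fderiv ℝ f y (gradG f G y)) • G y

theorem schouten_apply (f : E → ℝ) (G : E → E →L[ℝ] E →L[ℝ] ℝ) (y v w : E) :
    schouten f G y v w = hessG f G y v w - fderiv ℝ f y v * fderiv ℝ f y w
      + 1 / 2 * fderiv ℝ f y (gradG f G y) * G y v w := by
  simp [schouten, hessG]

namespace IsMetricOn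

variable {f : E → ℝ} {G : E → E →L[ℝ] E →L[ℝ] ℝ} {Ω : Set E} {y : E}

theorem apply_gradG (hG : IsMetricOn G Ω) (hy : y ∈ Ω) (w : E) :
    G y (gradG f G y) w = fderiv ℝ f y w :=
  hG.apply_inverse hy _ w

theorem hessG_comm (hG : IsMetricOn G Ω) (hf : ContDiffOn ℝ ∞ f Ω) (hy : y ∈ Ω) (v w : E) :
    hessG f G y v w = hessG f G y w v := by
  rw [hessG, hessG, hG.christoffel_comm hy, fderiv_fderiv_comm hG.isOpen hf hy]

theorem schouten_comm (hG : IsMetricOn G Ω) (hf : ContDiffOn ℝ ∞ f Ω) (hy : y ∈ Ω) (v w : E) :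
    schouten f G y v w = schouten f G y w v := by
  rw [schouten_apply, schouten_apply, hG.hessG_comm hf hy, hG.symm y hy]
  ring

theorem conformal (hG : IsMetricOn G Ω) (hf : ContDiffOn ℝ ∞ f Ω) :
    IsMetricOn (conformalMetric f G) Ω where
  isOpen := hG.isOpen
  contDiffOn := (Real.contDiff_exp.comp_contDiffOn (contDiffOn_const.mul hf)).smul hG.contDiffOn
  symm y hy v w := by simp [conformalMetric, hG.symm y hy v w]
  isInvertible y hy := by
    obtain ⟨e, he⟩ := hG.isInvertible y hy
    refine ⟨e.trans (ContinuousLinearEquiv.smulLeft (Units.mk0 _ (Real.exp_ne_zero (2 * f y)))), ?_⟩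
    ext v w
    simp [conformalMetric, ← he, Units.smul_def]

/-- The Levi-Civita connection of a conformal metric. -/
theorem christoffel_conformal (hG : IsMetricOn G Ω) (hf : ContDiffOn ℝ ∞ f Ω) (hy : y ∈ Ω)
    (v w : E) :
    christoffel (conformalMetric f G) y v w = christoffel G y v w +
      (fderiv ℝ f y v • w + fderiv ℝ f y w • v - G y v w • gradG f G y) := by
  have hf' := hasFDerivAt_of_contDiffOn hG.isOpen hf hy
  refine (hG.conformal hf).christoffel_unique hy (fun v w => christoffel G y v w +
      (fderiv ℝ f y v • w + fderiv ℝ f y w • v - G y v w • gradG f G y)) (fun v w => ?_)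
      (fun u v w => ?_) v w
  · rw [hG.christoffel_comm hy, hG.symm y hy v w]
    abel
  · have e1 : HasFDerivAt (conformalMetric f G) _ y :=
      (hf'.const_mul 2).exp.smul (hG.hasFDerivAt hy)
    rw [e1.fderiv]
    simp only [conformalMetric, add_apply, smul_apply, ContinuousLinearMap.smulRight_apply,
      map_add, map_sub, map_smul, sub_apply, smul_eq_mul, hG.fderiv_eq hy u v w,
      hG.apply_gradG hy, hG.symm y hy v (gradG f G y)]
    rw [hG.symm y hy v u]
    ring

variable [CompleteSpace E]

theorem contDiffOn_gradG (hG : IsMetricOn G Ω) (hf : ContDiffOn ℝ ∞ f Ω) :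
    ContDiffOn ℝ ∞ (gradG f G) Ω :=
  hG.contDiffOn_inverse.clm_apply (contDiffOn_fderiv hG.isOpen hf)

theorem contDiffOn_schouten (hG : IsMetricOn G Ω) (hf : ContDiffOn ℝ ∞ f Ω) :
    ContDiffOn ℝ ∞ (schouten f G) Ω := by
  have h1 := contDiffOn_fderiv hG.isOpen hf
  have h2 := contDiffOn_fderiv hG.isOpen h1
  have h3 := ((ContinuousLinearMap.compL ℝ E E ℝ).contDiff.comp_contDiffOn h1).clm_comp
    hG.contDiffOn_christoffel
  exact ((h2.sub h3).sub (h1.smulRight h1)).add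
    ((contDiffOn_const.mul (h1.clm_apply (hG.contDiffOn_gradG hf))).smul hG.contDiffOn)

/-- Differentiate `G(grad f, w) = df(w)` and use that the connection is metric. -/
theorem apply_covGradG (hG : IsMetricOn G Ω) (hf : ContDiffOn ℝ ∞ f Ω) (hy : y ∈ Ω) (v w : E) :
    G y (covGradG f G y v) w = hessG f G y v w := by
  have h1 := hasFDerivAt_of_contDiffOn hG.isOpen (contDiffOn_fderiv hG.isOpen hf) hy
  have h2 := hasFDerivAt_of_contDiffOn hG.isOpen (hG.contDiffOn_gradG hf) hy
  have e1 := ((hG.hasFDerivAt hy).clm_apply h2).clm_apply (hasFDerivAt_const w y)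
  have e2 := h1.clm_apply (hasFDerivAt_const w y)
  have e3 := congrArg (fun L => L v) (e2.unique (e1.congr_of_eventuallyEq (by
    filter_upwards [hG.eventually_mem hy] with z hz using (hG.apply_gradG hz w).symm)))
  simp at e3
  rw [hG.fderiv_eq hy, hG.apply_gradG hy] at e3
  rw [covGradG, hessG, e3, map_add, add_apply]
  ring

/-- The curvature tensor of `G` in terms of its Schouten tensor, if `e^{2f} G` is flat. -/
theorem curvatureEnd_eq_of_flat (hG : IsMetricOn G Ω) (hf : ContDiffOn ℝ ∞ f Ω)
    (hflat : ∀ y ∈ Ω, ∀ x z v, curvatureEnd (conformalMetric f G) y x z v = 0) (hy : y ∈ Ω)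
    (x z v : E) :
    curvatureEnd G y x z v = schouten f G y x z • v - schouten f G y v z • x
      + G y x z • (G y).inverse (schouten f G y v)
      - G y v z • (G y).inverse (schouten f G y x) := by
  have h1 := hasFDerivAt_of_contDiffOn hG.isOpen (contDiffOn_fderiv hG.isOpen hf) hy
  have h2 := hasFDerivAt_of_contDiffOn hG.isOpen (hG.contDiffOn_gradG hf) hy
  have hΓ := hasFDerivAt_of_contDiffOn hG.isOpen hG.contDiffOn_christoffel hy
  have hΓ' := hasFDerivAt_of_contDiffOn hG.isOpen (hG.conformal hf).contDiffOn_christoffel hy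
  -- The derivative of the conformal Christoffel formula, with `∂_v grad f` written through the
  -- covariant derivative so that Hessians appear below.
  have key : ∀ v x z : E, fderiv ℝ (christoffel (conformalMetric f G)) y v x z =
      fderiv ℝ (christoffel G) y v x z + (fderiv ℝ (fderiv ℝ f) y v x • z
        + fderiv ℝ (fderiv ℝ f) y v z • x
        - (G y (christoffel G y v x) z + G y x (christoffel G y v z)) • gradG f G y
        - G y x z • (covGradG f G y v - christoffel G y v (gradG f G y))) := by
    intro v x z
    have e1 := (hasFDerivAt_apply_apply hΓ x z).add
      ((((h1.clm_apply (hasFDerivAt_const x y)).smul (hasFDerivAt_const z y)).add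
        ((h1.clm_apply (hasFDerivAt_const z y)).smul (hasFDerivAt_const x y))).sub
          ((hasFDerivAt_apply_apply (hG.hasFDerivAt hy) x z).smul h2))
    have e2 := congrArg (fun L => L v) ((hasFDerivAt_apply_apply hΓ' x z).unique
      (e1.congr_of_eventuallyEq (by
        filter_upwards [hG.eventually_mem hy] with w hw using hG.christoffel_conformal hf hw x z)))
    simp at e2
    rw [e2, hG.fderiv_eq hy, covGradG]
    module
  have hP : ∀ v, (G y).inverse (schouten f G y v) = covGradG f G y v - fderiv ℝ f y v • gradG f G y
      + (1 / 2 * fderiv ℝ f y (gradG f G y)) • v := by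
    intro v
    refine hG.eq_of_forall hy fun w => ?_
    rw [hG.apply_inverse hy, schouten_apply]
    simp [hG.apply_covGradG hf hy, hG.apply_gradG hy]
  have h := hflat y hy x z v
  simp only [curvatureEnd, LinearMap.coe_mk, AddHom.coe_mk, key, hG.christoffel_conformal hf hy,
    map_add, map_sub, map_smul, hG.apply_gradG hy, hG.symm y hy _ (gradG f G y), smul_eq_mul] at h ⊢
  rw [hP, hP, schouten_apply, schouten_apply, hessG, hessG]
  rw [hG.symm y hy v x, fderiv_fderiv_comm hG.isOpen hf hy x v, hG.christoffel_comm hy x v] at h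
  linear_combination (norm := module) h

end IsMetricOn

end Conformal

/-! ### Covariant derivatives of bilinear forms and the Codazzi equation -/

section Parallel

variable {E : Type*} [NormedAddCommGroup E] [NormedSpace ℝ E]

/-- The covariant derivative `(∇_u T)(v, w)` of a field `T` of bilinear forms. -/
def covDeriv (G T : E → E →L[ℝ] E →L[ℝ] ℝ) (y u v w : E) : ℝ :=
  fderiv ℝ T y u v w - T y (christoffel G y u v) w - T y v (christoffel G y u w)

/-- The field of endomorphisms obtained from a field of bilinear forms by raising an index. -/
def sharp (G T : E → E →L[ℝ] E →L[ℝ] ℝ) (y : E) : E →L[ℝ] E :=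
  (G y).inverse ∘L T y

namespace IsMetricOn

variable {f : E → ℝ} {G T : E → E →L[ℝ] E →L[ℝ] ℝ} {Ω : Set E} {y : E}

theorem covDeriv_swap (hG : IsMetricOn G Ω) (hT : ContDiffOn ℝ ∞ T Ω)
    (hsymm : ∀ z ∈ Ω, ∀ v w, T z v w = T z w v) (hy : y ∈ Ω) (u v w : E) :
    covDeriv G T y u v w = covDeriv G T y u w v := by
  have h1 := hasFDerivAt_of_contDiffOn hG.isOpen hT hy
  have e := congrArg (fun L => L u) ((hasFDerivAt_apply_apply h1 v w).unique
    ((hasFDerivAt_apply_apply h1 w v).congr_of_eventuallyEq (by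
      filter_upwards [hG.eventually_mem hy] with z hz using hsymm z hz v w)))
  simp at e
  rw [covDeriv, covDeriv, e, hsymm y hy v, hsymm y hy _ w]
  ring

theorem apply_sharp (hG : IsMetricOn G Ω) (hy : y ∈ Ω) (v w : E) :
    G y (sharp G T y v) w = T y v w :=
  hG.apply_inverse hy _ w

variable [CompleteSpace E]

theorem contDiffOn_sharp (hG : IsMetricOn G Ω) (hT : ContDiffOn ℝ ∞ T Ω) :
    ContDiffOn ℝ ∞ (sharp G T) Ω :=
  hG.contDiffOn_inverse.clm_comp hT

/-- Raising an index commutes with covariant differentiation. -/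
theorem apply_fderiv_sharp (hG : IsMetricOn G Ω) (hT : ContDiffOn ℝ ∞ T Ω) (hy : y ∈ Ω)
    (u v w : E) :
    G y (fderiv ℝ (sharp G T) y u v + christoffel G y u (sharp G T y v)
      - sharp G T y (christoffel G y u v)) w = covDeriv G T y u v w := by
  have h1 := hasFDerivAt_of_contDiffOn hG.isOpen hT hy
  have h2 := hasFDerivAt_of_contDiffOn hG.isOpen (hG.contDiffOn_sharp hT) hy
  have e1 := ((hG.hasFDerivAt hy).clm_apply (h2.clm_apply (hasFDerivAt_const v y))).clm_apply
    (hasFDerivAt_const w y)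
  have e := congrArg (fun L => L u) ((hasFDerivAt_apply_apply h1 v w).unique
    (e1.congr_of_eventuallyEq (by
      filter_upwards [hG.eventually_mem hy] with z hz using (hG.apply_sharp hz v w).symm)))
  simp at e
  rw [hG.fderiv_eq hy, hG.apply_sharp hy] at e
  simp only [map_add, map_sub, add_apply, sub_apply, covDeriv, hG.apply_sharp hy, e]
  ring

/-- The Schouten tensor of a locally conformally flat metric is a Codazzi tensor. -/
theorem schouten_codazzi (hG : IsMetricOn G Ω) (hf : ContDiffOn ℝ ∞ f Ω)
    (hflat : ∀ y ∈ Ω, ∀ x z v, curvatureEnd (conformalMetric f G) y x z v = 0) (hy : y ∈ Ω)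
    (u v w : E) :
    covDeriv G (schouten f G) y u v w = covDeriv G (schouten f G) y v u w := by
  have hs1 := contDiffOn_fderiv hG.isOpen hf
  have hs2 := contDiffOn_fderiv hG.isOpen hs1
  have h1 := hasFDerivAt_of_contDiffOn hG.isOpen hs1 hy
  have h2 := hasFDerivAt_of_contDiffOn hG.isOpen hs2 hy
  have hgr := hasFDerivAt_of_contDiffOn hG.isOpen (hG.contDiffOn_gradG hf) hy
  have hΓ := hasFDerivAt_of_contDiffOn hG.isOpen hG.contDiffOn_christoffel hy
  have hP := hasFDerivAt_of_contDiffOn hG.isOpen (hG.contDiffOn_schouten hf) hy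
  have key : ∀ u v w : E, fderiv ℝ (schouten f G) y u v w =
      fderiv ℝ (fderiv ℝ (fderiv ℝ f)) y u v w
      - fderiv ℝ (fderiv ℝ f) y u (christoffel G y v w)
      - fderiv ℝ f y (fderiv ℝ (christoffel G) y u v w)
      - (fderiv ℝ (fderiv ℝ f) y u v * fderiv ℝ f y w
        + fderiv ℝ f y v * fderiv ℝ (fderiv ℝ f) y u w)
      + 1 / 2 * (fderiv ℝ (fderiv ℝ f) y u (gradG f G y)
        + fderiv ℝ f y (fderiv ℝ (gradG f G) y u)) * G y v w
      + 1 / 2 * fderiv ℝ f y (gradG f G y)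
        * (G y (christoffel G y u v) w + G y v (christoffel G y u w)) := by
    intro u v w
    have e1 := (((hasFDerivAt_apply_apply h2 v w).sub
      (h1.clm_apply (hasFDerivAt_apply_apply hΓ v w))).sub
        ((h1.clm_apply (hasFDerivAt_const v y)).mul (h1.clm_apply (hasFDerivAt_const w y)))).add
          (((h1.clm_apply hgr).const_mul (1 / 2)).mul
            (hasFDerivAt_apply_apply (hG.hasFDerivAt hy) v w))
    have e := congrArg (fun L => L u) ((hasFDerivAt_apply_apply hP v w).unique
      (e1.congr_of_eventuallyEq (by
        filter_upwards with z using schouten_apply f G z v w)))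
    simp at e
    rw [e, hG.fderiv_eq hy]
    ring
  have hφ : ∀ a, fderiv ℝ f y a = G y a (gradG f G y) := fun a => by
    rw [hG.symm y hy, hG.apply_gradG hy]
  have hN : ∀ u, fderiv ℝ f y (fderiv ℝ (gradG f G) y u) =
      hessG f G y u (gradG f G y) - fderiv ℝ f y (christoffel G y u (gradG f G y)) := fun u => by
    rw [← hG.apply_covGradG hf hy, ← hφ, covGradG, map_add]
    ring
  have hS : ∀ u, fderiv ℝ f y ((G y).inverse (schouten f G y u)) =
      schouten f G y u (gradG f G y) := fun u => by
    rw [hφ, hG.apply_inverse hy]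
  -- Ricci identity: antisymmetrizing `∇²df` in its first two slots produces `df` of the curvature.
  -- Expressed through `P`, this cancels the derivatives of `df ⊗ df` and `|df|² G / 2`.
  have hR := congrArg (fderiv ℝ f y) (hG.curvatureEnd_eq_of_flat hf hflat hy v w u)
  simp only [map_add, map_sub, map_smul, smul_eq_mul, hS] at hR
  simp only [curvatureEnd, LinearMap.coe_mk, AddHom.coe_mk, map_add, map_sub] at hR
  simp only [schouten_apply, hessG, ← hφ] at hR
  simp only [covDeriv, key, hN, schouten_apply, hessG]
  rw [fderiv_fderiv_comm hG.isOpen hs1 hy u v, hG.christoffel_comm hy u v]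
  rw [fderiv_fderiv_comm hG.isOpen hf hy u v]
  linear_combination -hR

end IsMetricOn

end Parallel

/-! ### A Killing Ricci tensor of a conformally flat metric is parallel -/

section Ricci

variable {E : Type*} [NormedAddCommGroup E] [NormedSpace ℝ E]

/-- The trace of a continuous endomorphism. -/
def traceL (E : Type*) [NormedAddCommGroup E] [NormedSpace ℝ E] [FiniteDimensional ℝ E] :
    (E →L[ℝ] E) →L[ℝ] ℝ :=
  LinearMap.toContinuousLinearMap (LinearMap.trace ℝ E ∘ₗ ContinuousLinearMap.coeLM ℝ)

section

variable [FiniteDimensional ℝ E]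

theorem traceL_comp_comm (A B : E →L[ℝ] E) : traceL E (A ∘L B) = traceL E (B ∘L A) :=
  LinearMap.trace_mul_comm ℝ (A : E →ₗ[ℝ] E) B

theorem traceL_id : traceL E (ContinuousLinearMap.id ℝ E) = Module.finrank ℝ E :=
  LinearMap.trace_id ℝ E

theorem traceL_smulRight (a : E →L[ℝ] ℝ) (x : E) : traceL E (a.smulRight x) = a x :=
  LinearMap.trace_smulRight (a : E →ₗ[ℝ] ℝ) x

end

/-- The Ricci operator `(n - 2) S + tr S` of a locally conformally flat metric whose Schouten tensor
is `schouten f G`, with `S` the associated endomorphism. -/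
def ricciOpOfSchouten [FiniteDimensional ℝ E] (f : E → ℝ) (G : E → E →L[ℝ] E →L[ℝ] ℝ) (y : E) :
    E →L[ℝ] E :=
  ((Module.finrank ℝ E : ℝ) - 2) • sharp G (schouten f G) y +
    traceL E (sharp G (schouten f G) y) • ContinuousLinearMap.id ℝ E

/-- Polarization of a cubic form. -/
theorem polarize_cubic {E : Type*} [AddCommGroup E] (a : E → E → E → ℝ) (t : E → ℝ) (b : E → E → ℝ)
    (k : ℝ)
    (ha : ∀ u u' v w, a (u + u') v w = a u v w + a u' v w)
    (ha₁ : ∀ u v w, a u v w = a v u w) (ha₂ : ∀ u v w, a u v w = a u w v)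
    (ht : ∀ u u', t (u + u') = t u + t u')
    (hb : ∀ u u' v, b (u + u') v = b u v + b u' v) (hb₁ : ∀ u v, b u v = b v u)
    (h : ∀ v, k * a v v v + t v * b v v = 0) (u v w : E) :
    3 * k * a u v w + t u * b v w + t v * b u w + t w * b u v = 0 := by
  have hb' : ∀ u u' v, b v (u + u') = b v u + b v u' := fun u u' v => by
    rw [hb₁, hb, hb₁ u, hb₁ u']
  have ha' : ∀ u u' v w, a v (u + u') w = a v u w + a v u' w := fun u u' v w => by
    rw [ha₁, ha, ha₁ u, ha₁ u']
  have ha'' : ∀ u u' v w, a v w (u + u') = a v w u + a v w u' := fun u u' v w => by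
    rw [ha₂, ha', ha₂ v u, ha₂ v u']
  have h1 := h (u + v + w)
  have h2 := h (u + v)
  have h3 := h (u + w)
  have h4 := h (v + w)
  simp only [ha, ha', ha'', ht, hb, hb'] at h1 h2 h3 h4
  have s1 : a u w v = a u v w := ha₂ _ _ _
  have s2 : a v u w = a u v w := ha₁ _ _ _
  have s3 : a v w u = a u v w := by rw [ha₂, ha₁]
  have s4 : a w u v = a u v w := by rw [ha₁, ha₂]
  have s5 : a w v u = a u v w := by rw [ha₂, s4]
  rw [s1, s2, s3, s4, s5, hb₁ v u, hb₁ w u, hb₁ w v] at h1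
  rw [hb₁ v u] at h2
  rw [hb₁ w u] at h3
  rw [hb₁ w v] at h4
  linear_combination (h1 - h2 - h3 - h4 + h u + h v + h w) / 2

namespace IsMetricOn

variable [FiniteDimensional ℝ E] {f : E → ℝ} {G T : E → E →L[ℝ] E →L[ℝ] ℝ} {Ω : Set E} {y : E}

/-- Trace of the curvature formula: the identity term gives `n P(x, z)`, each rank-one term `-P(x,
z)`, and the last one `G(x, z) tr S`. -/
theorem ricciForm_eq_of_flat (hG : IsMetricOn G Ω) (hf : ContDiffOn ℝ ∞ f Ω)
    (hflat : ∀ y ∈ Ω, ∀ x z v, curvatureEnd (conformalMetric f G) y x z v = 0) (hy : y ∈ Ω)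
    (x z : E) :
    ricciForm G y x z = G y (ricciOpOfSchouten f G y x) z := by
  have : CompleteSpace E := FiniteDimensional.complete ℝ E
  have h : curvatureEnd G y x z = (schouten f G y x z • ContinuousLinearMap.id ℝ E
      - (schouten f G y z).smulRight x + G y x z • sharp G (schouten f G) y
      - (G y z).smulRight (sharp G (schouten f G) y x) : E →L[ℝ] E) := by
    ext v
    rw [hG.curvatureEnd_eq_of_flat hf hflat hy, hG.schouten_comm hf hy v, hG.symm y hy v]
    simp [sharp]
  have h2 : ricciForm G y x z = traceL E (schouten f G y x z • ContinuousLinearMap.id ℝ E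
      - (schouten f G y z).smulRight x + G y x z • sharp G (schouten f G) y
      - (G y z).smulRight (sharp G (schouten f G) y x)) := congrArg (LinearMap.trace ℝ E) h
  rw [h2]
  simp only [map_add, map_sub, map_smul, traceL_id, traceL_smulRight, smul_eq_mul,
    ricciOpOfSchouten, add_apply, smul_apply, hG.apply_sharp hy, ContinuousLinearMap.id_apply]
  rw [hG.schouten_comm hf hy z, hG.symm y hy z, hG.apply_sharp hy]
  ring

/-- If the Ricci tensor of a locally conformally flat metric is a Killing tensor, then it is
parallel. -/
theorem fderiv_ricciOpOfSchouten (hG : IsMetricOn G Ω) (hf : ContDiffOn ℝ ∞ f Ω)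
    (hflat : ∀ y ∈ Ω, ∀ x z v, curvatureEnd (conformalMetric f G) y x z v = 0) (hy : y ∈ Ω)
    (hn : 3 ≤ Module.finrank ℝ E)
    (hK : ∀ v, ((Module.finrank ℝ E : ℝ) - 2) * covDeriv G (schouten f G) y v v v
      + traceL E (fderiv ℝ (sharp G (schouten f G)) y v) * G y v v = 0) (u : E) :
    fderiv ℝ (ricciOpOfSchouten f G) y u = ricciOpOfSchouten f G y ∘L christoffel G y u
      - christoffel G y u ∘L ricciOpOfSchouten f G y := by
  have : CompleteSpace E := FiniteDimensional.complete ℝ E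
  have hP := hG.contDiffOn_schouten hf
  have hS := hasFDerivAt_of_contDiffOn hG.isOpen (hG.contDiffOn_sharp hP) hy
  set k : ℝ := (Module.finrank ℝ E : ℝ) - 2 with hk
  have hk1 : 1 ≤ k := by
    have : (3 : ℝ) ≤ Module.finrank ℝ E := by exact_mod_cast hn
    linarith
  set S := sharp G (schouten f G) with hSdef
  set t : E →L[ℝ] ℝ := traceL E ∘L fderiv ℝ S y with ht
  have hpol := polarize_cubic (covDeriv G (schouten f G) y) t (fun v w => G y v w) k
    (fun u u' v w => by simp [covDeriv]; ring) (hG.schouten_codazzi hf hflat hy)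
    (hG.covDeriv_swap hP (fun z hz => hG.schouten_comm hf hz) hy) (map_add t)
    (fun u u' v => by simp) (hG.symm y hy) hK
  -- The polarized identity with `w` raised, as an equation of endomorphisms whose trace can be
  -- taken.
  have hvec : ∀ u, (3 * k) • (fderiv ℝ S y u + christoffel G y u ∘L S y - S y ∘L christoffel G y u)
      + t u • ContinuousLinearMap.id ℝ E + t.smulRight u
      + (G y u).smulRight ((G y).inverse t) = 0 := by
    intro u
    ext v
    refine hG.eq_of_forall hy fun w => ?_
    have h1 := hG.apply_fderiv_sharp hP hy u v w
    simp only [← hSdef] at h1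
    simp only [add_apply, smul_apply, map_add, map_smul, sub_apply, ContinuousLinearMap.comp_apply,
      h1, smul_eq_mul, ContinuousLinearMap.smulRight_apply, hG.apply_inverse hy,
      ContinuousLinearMap.id_apply, zero_apply, map_zero]
    linear_combination hpol u v w
  have ht0 : ∀ u, t u = 0 := by
    intro u
    have h := congrArg (traceL E) (hvec u)
    simp only [map_add, map_sub, map_smul, traceL_id, traceL_smulRight, smul_eq_mul, map_zero,
      traceL_comp_comm (S y)] at h
    rw [hG.symm y hy, hG.apply_inverse hy] at h
    -- In the trace `∇_u S` counts `3k` (its commutator part is traceless), the identity `n = k +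
    -- 2`, and the two rank-one terms one each.
    have h' : (3 * k + (k + 2) + 2) * t u = 0 := by
      have : t u = traceL E (fderiv ℝ S y u) := rfl
      rw [hk] at h ⊢
      linear_combination h + 3 * (Module.finrank ℝ E - 2 : ℝ) * this
    rcases mul_eq_zero.1 h' with h0 | h0
    · linarith
    · exact h0
  have ht1 : t = 0 := by ext u; exact ht0 u
  have hpar : fderiv ℝ S y u = S y ∘L christoffel G y u - christoffel G y u ∘L S y := by
    have h := hvec u
    have hinv : (G y).inverse (0 : E →L[ℝ] ℝ) = 0 := map_zero _
    rw [ht0, ht1, hinv] at h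
    have h0 : (3 * k) • (fderiv ℝ S y u + christoffel G y u ∘L S y - S y ∘L christoffel G y u)
      = 0 := by
      ext v
      have := congrArg (fun L => L v) h
      simpa using this
    -- Dividing by `3(n - 2)` requires `n > 2`.
    have h3 := (smul_eq_zero.1 h0).resolve_left (by linarith)
    rw [eq_sub_iff_add_eq, ← sub_eq_zero, h3]
  have hρ : HasFDerivAt (ricciOpOfSchouten f G) _ y := (hS.const_smul k).add
    (((traceL E).hasFDerivAt.comp y hS).smul (hasFDerivAt_const (ContinuousLinearMap.id ℝ E) y))
  rw [hρ.fderiv]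
  ext v
  have h0 : traceL E (fderiv ℝ S y u) = 0 := ht0 u
  simp [hpar, ricciOpOfSchouten, ← hSdef, ← hk]
  rw [hpar] at h0
  simp at h0
  simp [h0]
  module

end IsMetricOn

end Ricci

/-! ### Parallel endomorphisms have constant characteristic polynomial -/

section Charpoly

variable {E : Type*} [NormedAddCommGroup E] [NormedSpace ℝ E] [FiniteDimensional ℝ E]

theorem differentiable_det :
    Differentiable ℝ (fun A : E →L[ℝ] E => LinearMap.det (A : E →ₗ[ℝ] E)) := by
  let b := Module.finBasis ℝ E
  have h : (fun A : E →L[ℝ] E => LinearMap.det (A : E →ₗ[ℝ] E)) =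
      fun A => ∑ σ : Equiv.Perm (Fin (Module.finrank ℝ E)), (Equiv.Perm.sign σ : ℤ) •
        ∏ i, (LinearMap.toContinuousLinearMap (b.coord (σ i))) (A (b i)) := by
    ext A
    rw [← LinearMap.det_toMatrix b, Matrix.det_apply]
    simp [LinearMap.toMatrix_apply, Units.smul_def]
  rw [h]
  fun_prop

/-- The differential of the determinant vanishes on commutators. -/
theorem fderiv_det_commutator (A B : E →L[ℝ] E) :
    fderiv ℝ (fun A : E →L[ℝ] E => LinearMap.det (A : E →ₗ[ℝ] E)) A (A * B - B * A) = 0 := by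
  have : CompleteSpace E := FiniteDimensional.complete ℝ E
  have h1 : HasDerivAt (fun t : ℝ => NormedSpace.exp (t • B)) B 0 := by
    simpa using hasDerivAt_exp_smul_const (𝕂 := ℝ) B (0 : ℝ)
  have h2 : HasDerivAt (fun t : ℝ => NormedSpace.exp (t • (-B))) (-B) 0 := by
    simpa using hasDerivAt_exp_smul_const (𝕂 := ℝ) (-B) (0 : ℝ)
  -- The commutator is the velocity at `0` of a curve of conjugates of `A`, on which the determinant
  -- is constant.
  have h3 : HasDerivAt (fun t : ℝ => NormedSpace.exp (t • (-B)) * A * NormedSpace.exp (t • B))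
      (A * B - B * A) 0 := by
    have := (h2.mul_const A).mul h1
    convert! this using 1
    simp
    abel
  have h4 := (differentiable_det (E := E) A).hasFDerivAt
  have h5 := h4.comp_hasDerivAt_of_eq (0 : ℝ) h3 (by simp)
  have h6 : (fun A : E →L[ℝ] E => LinearMap.det (A : E →ₗ[ℝ] E)) ∘
      (fun t : ℝ => NormedSpace.exp (t • (-B)) * A * NormedSpace.exp (t • B)) =
      fun _ => LinearMap.det (A : E →ₗ[ℝ] E) := by
    ext t
    let _ : NormedAlgebra ℚ (E →L[ℝ] E) := NormedAlgebra.restrictScalars ℚ ℝ _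
    have : NormedSpace.exp (t • (-B)) * NormedSpace.exp (t • B) = 1 := by
      rw [smul_neg, ← NormedSpace.exp_add_of_commute (Commute.neg_left (Commute.refl _))]
      simp
    have h := congrArg (fun L : E →L[ℝ] E => LinearMap.det (L : E →ₗ[ℝ] E)) this
    simp only [ContinuousLinearMap.toLinearMap_mul, map_mul] at h
    simp only [Function.comp, ContinuousLinearMap.toLinearMap_mul, map_mul]
    rw [mul_right_comm, h]
    simp
  rw [h6] at h5
  exact h5.unique (hasDerivAt_const _ _)

/-- A field of endomorphisms which is parallel for some connection has constant characteristic
polynomial. -/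
theorem charpoly_eq_of_parallel {ρ : E → E →L[ℝ] E} {Γ : E → E →L[ℝ] E →L[ℝ] E} {Ω : Set E}
    (hΩ : IsOpen Ω) (hc : IsPreconnected Ω) (hρ : DifferentiableOn ℝ ρ Ω)
    (h : ∀ y ∈ Ω, ∀ u, fderiv ℝ ρ y u = ρ y ∘L Γ y u - Γ y u ∘L ρ y) {y z : E} (hy : y ∈ Ω)
    (hz : z ∈ Ω) : (ρ y : E →ₗ[ℝ] E).charpoly = (ρ z : E →ₗ[ℝ] E).charpoly := by
  refine Polynomial.funext fun s => ?_
  rw [LinearMap.eval_charpoly, LinearMap.eval_charpoly]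
  let D : E → ℝ := fun y => LinearMap.det ((s • 1 - ρ y : E →L[ℝ] E) : E →ₗ[ℝ] E)
  have hD : ∀ x ∈ Ω, HasFDerivAt D (0 : E →L[ℝ] ℝ) x := by
    intro x hx
    have h1 : HasFDerivAt ρ (fderiv ℝ ρ x) x :=
      ((hρ x hx).differentiableAt (hΩ.mem_nhds hx)).hasFDerivAt
    have h2 := ((differentiable_det (E := E) (s • 1 - ρ x)).hasFDerivAt).comp x
      (h1.const_sub (s • (1 : E →L[ℝ] E)))
    convert! h2 using 1
    ext u
    have h3 := fderiv_det_commutator (s • 1 - ρ x) (Γ x u)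
    -- Scalars commute with everything, so `s - ρ` inherits the commutator form of the derivative of
    -- `ρ`.
    have h4 : (s • 1 - ρ x) * Γ x u - Γ x u * (s • 1 - ρ x) = - fderiv ℝ ρ x u := by
      rw [h x hx u]
      ext v
      simp
    rw [h4] at h3
    simpa using h3.symm
  have hconst := hΩ.is_const_of_fderiv_eq_zero (𝕜 := ℝ) (f := D) hc
    (fun x hx => (hD x hx).differentiableAt.differentiableWithinAt) (fun x hx => (hD x hx).fderiv)
    hy hz
  have e : ∀ x, LinearMap.det (algebraMap ℝ (Module.End ℝ E) s - (ρ x : E →ₗ[ℝ] E)) = D x := by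
    intro x
    simp only [D]
    congr 1
  rw [e, e, hconst]

end Charpoly

/-! ### Local geodesics and the Killing equation -/

section Geodesic

variable {E : Type*} [NormedAddCommGroup E] [NormedSpace ℝ E]

/-- Bootstrapping: if `α` is `C^k`, so is `α' = F ∘ α`, hence `α` is `C^(k+1)`. -/
theorem contDiffOn_of_hasDerivAt {F : E → E} {U : Set E} (hF : ContDiffOn ℝ ∞ F U) {J : Set ℝ}
    (hJ : IsOpen J) {α : ℝ → E} (hα : ∀ t ∈ J, HasDerivAt α (F (α t)) t) (hU : Set.MapsTo α J U) :
    ContDiffOn ℝ ∞ α J := by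
  have h : ∀ k : ℕ, ContDiffOn ℝ k α J := by
    intro k
    induction k with
    | zero => exact contDiffOn_zero.2 fun t ht => (hα t ht).continuousAt.continuousWithinAt
    | succ k ih =>
      rw [Nat.cast_add, Nat.cast_one, contDiffOn_succ_iff_deriv_of_isOpen hJ]
      refine ⟨fun t ht => (hα t ht).differentiableAt.differentiableWithinAt, by simp, ?_⟩
      exact ((hF.of_le (by exact_mod_cast le_top)).comp ih hU).congr fun t ht => (hα t ht).deriv
  exact contDiffOn_infty.2 h

/-- `u` is a smooth curve in `Ω`, defined on `J`, which satisfies the geodesic equation of `G`. -/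
structure IsLocalGeodesicOn (G : E → E →L[ℝ] E →L[ℝ] ℝ) (Ω : Set E) (u : ℝ → E) (J : Set ℝ) :
    Prop where
  contDiffOn : ContDiffOn ℝ ∞ u J
  mapsTo : Set.MapsTo u J Ω
  hasDerivAt_deriv : ∀ t ∈ J,
    HasDerivAt (deriv u) (-christoffel G (u t) (deriv u t) (deriv u t)) t

theorem IsLocalGeodesicOn.hasDerivAt {G : E → E →L[ℝ] E →L[ℝ] ℝ} {Ω : Set E} {u : ℝ → E}
    {J : Set ℝ} (h : IsLocalGeodesicOn G Ω u J) (hJ : IsOpen J) {t : ℝ} (ht : t ∈ J) :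
    HasDerivAt u (deriv u t) t :=
  ((h.contDiffOn.contDiffAt (hJ.mem_nhds ht)).differentiableAt (by simp)).hasDerivAt

namespace IsMetricOn

variable {f : E → ℝ} {G T : E → E →L[ℝ] E →L[ℝ] ℝ} {Ω : Set E} {y : E}

/-- Picard-Lindelöf for the first-order system `x' = w`, `w' = -Γ(w, w)` on `E × E`. -/
theorem exists_geodesic [CompleteSpace E] (hG : IsMetricOn G Ω) (hy : y ∈ Ω) (v : E) :
    ∃ u : ℝ → E, ∃ ε : ℝ, 0 < ε ∧ u 0 = y ∧ deriv u 0 = v ∧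
      IsLocalGeodesicOn G Ω u (Set.Ioo (-ε) ε) := by
  let F : E × E → E × E := fun p => (p.2, -christoffel G p.1 p.2 p.2)
  have hF : ContDiffOn ℝ ∞ F (Ω ×ˢ Set.univ) := by
    have h1 : ContDiffOn ℝ ∞ (fun p : E × E => christoffel G p.1) (Ω ×ˢ Set.univ) :=
      hG.contDiffOn_christoffel.comp contDiffOn_fst fun p hp => hp.1
    exact contDiffOn_snd.prodMk ((h1.clm_apply contDiffOn_snd).clm_apply contDiffOn_snd).neg
  have hopen : IsOpen (Ω ×ˢ (Set.univ : Set E)) := hG.isOpen.prod isOpen_univ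
  have hF1 : ContDiffAt ℝ 1 F (y, v) :=
    (hF.contDiffAt (hopen.mem_nhds ⟨hy, trivial⟩)).of_le (by exact_mod_cast le_top)
  obtain ⟨α, hα0, δ, hδ, hα⟩ :=
    hF1.exists_forall_mem_closedBall_exists_eq_forall_mem_Ioo_hasDerivAt₀ 0
  have hα00 := hα 0 (by simp [hδ])
  have hev : ∀ᶠ t in 𝓝 (0 : ℝ), α t ∈ Ω ×ˢ (Set.univ : Set E) :=
    hα00.continuousAt.eventually_mem (hopen.mem_nhds (by rw [hα0]; exact ⟨hy, trivial⟩))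
  obtain ⟨η, hη, hηΩ⟩ := Metric.eventually_nhds_iff_ball.1 hev
  -- `δ` bounds the interval of existence, `η` the time during which the solution stays over `Ω`.
  let ε := min δ η
  have hε : 0 < ε := lt_min hδ hη
  have hsol : ∀ t ∈ Set.Ioo (-ε) ε, HasDerivAt α (F (α t)) t := fun t ht =>
    hα t ⟨by linarith [ht.1, min_le_left δ η], by linarith [ht.2, min_le_left δ η]⟩
  have hmaps : Set.MapsTo α (Set.Ioo (-ε) ε) (Ω ×ˢ Set.univ) := fun t ht => hηΩ t (by
    rw [Metric.mem_ball, Real.dist_eq, sub_zero, abs_lt]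
    exact ⟨by linarith [ht.1, min_le_right δ η], by linarith [ht.2, min_le_right δ η]⟩)
  have hsmooth := contDiffOn_of_hasDerivAt hF isOpen_Ioo hsol hmaps
  have hu : ∀ t ∈ Set.Ioo (-ε) ε, HasDerivAt (fun s => (α s).1) (α t).2 t := fun t ht =>
    (hsol t ht).fst
  have hw : ∀ t ∈ Set.Ioo (-ε) ε, HasDerivAt (fun s => (α s).2)
      (-christoffel G (α t).1 (α t).2 (α t).2) t := fun t ht => (hsol t ht).snd
  have h0 : (0 : ℝ) ∈ Set.Ioo (-ε) ε := by simp [hε]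
  refine ⟨fun s => (α s).1, ε, hε, by simp [hα0], by rw [(hu 0 h0).deriv, hα0],
    contDiff_fst.comp_contDiffOn hsmooth, fun t ht => (hmaps ht).1, fun t ht => ?_⟩
  rw [(hu t ht).deriv]
  refine (hw t ht).congr_of_eventuallyEq ?_
  filter_upwards [isOpen_Ioo.mem_nhds ht] with s hs using (hu s hs).deriv

/-- The derivative of `T(u', u')` along a geodesic `u`. -/
theorem hasDerivAt_apply_geodesic (hG : IsMetricOn G Ω) (hT : ContDiffOn ℝ ∞ T Ω) {u : ℝ → E}
    {J : Set ℝ} (hJ : IsOpen J) (hu : IsLocalGeodesicOn G Ω u J) {t : ℝ} (ht : t ∈ J) :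
    HasDerivAt (fun s => T (u s) (deriv u s) (deriv u s))
      (covDeriv G T (u t) (deriv u t) (deriv u t) (deriv u t)) t := by
  have h1 := hasFDerivAt_of_contDiffOn hG.isOpen hT (hu.mapsTo ht)
  have h2 := ((h1.comp_hasDerivAt t (hu.hasDerivAt hJ ht)).clm_apply
    (hu.hasDerivAt_deriv t ht)).clm_apply (hu.hasDerivAt_deriv t ht)
  convert! h2 using 1
  simp [covDeriv]
  ring

theorem covDeriv_self (hG : IsMetricOn G Ω) (hy : y ∈ Ω) (u v w : E) :
    covDeriv G G y u v w = 0 := by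
  rw [covDeriv, hG.fderiv_eq hy]
  ring

/-- If `Ric(u', u')` is constant along every geodesic `u`, then `Ric` is a Killing tensor. -/
theorem killing_of_geodesic [FiniteDimensional ℝ E] (hG : IsMetricOn G Ω)
    (hf : ContDiffOn ℝ ∞ f Ω) (hy : y ∈ Ω)
    (h : ∀ (u : ℝ → E) (ε : ℝ), 0 < ε → IsLocalGeodesicOn G Ω u (Set.Ioo (-ε) ε) →
      ∀ s ∈ Set.Ioo (-ε) ε, G (u s) (ricciOpOfSchouten f G (u s) (deriv u s)) (deriv u s) =
        G (u 0) (ricciOpOfSchouten f G (u 0) (deriv u 0)) (deriv u 0)) (v : E) :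
    ((Module.finrank ℝ E : ℝ) - 2) * covDeriv G (schouten f G) y v v v
      + traceL E (fderiv ℝ (sharp G (schouten f G)) y v) * G y v v = 0 := by
  have : CompleteSpace E := FiniteDimensional.complete ℝ E
  obtain ⟨u, ε, hε, hu0, hu1, hu⟩ := hG.exists_geodesic hy v
  have h0 : (0 : ℝ) ∈ Set.Ioo (-ε) ε := by simp [hε]
  have hP := hG.contDiffOn_schouten hf
  have hS := hasFDerivAt_of_contDiffOn hG.isOpen (hG.contDiffOn_sharp hP) (hu.mapsTo h0)
  have e1 := hG.hasDerivAt_apply_geodesic hP isOpen_Ioo hu h0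
  have e2 := hG.hasDerivAt_apply_geodesic hG.contDiffOn isOpen_Ioo hu h0
  have e3 := (traceL E).hasFDerivAt.comp_hasDerivAt (0 : ℝ)
    (hS.comp_hasDerivAt (0 : ℝ) (hu.hasDerivAt isOpen_Ioo h0))
  -- Derivative of `(n - 2) P(u', u') + tr S · G(u', u')`; the factor `G(u', u')` has derivative
  -- zero, since `G` is parallel.
  have e4 := (e1.const_mul ((Module.finrank ℝ E : ℝ) - 2)).add (e3.mul e2)
  have e5 := e4.congr_of_eventuallyEq (f₁ := fun _ =>
    G (u 0) (ricciOpOfSchouten f G (u 0) (deriv u 0)) (deriv u 0)) (by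
      filter_upwards [isOpen_Ioo.mem_nhds h0] with s hs
      rw [← h u ε hε hu s hs]
      simp [ricciOpOfSchouten, hG.apply_sharp (hu.mapsTo hs)])
  have e6 := e5.unique (hasDerivAt_const _ _)
  rw [hG.covDeriv_self (hu.mapsTo h0), hu0, hu1] at e6
  simpa using e6

/-- If `Ric(u', u')` is constant along every geodesic `u` of a locally
conformally flat metric, then the eigenvalues of the Ricci operator are constant. -/
theorem charpoly_ricciOpOfSchouten_eq [FiniteDimensional ℝ E] (hG : IsMetricOn G Ω)
    (hc : IsPreconnected Ω) (hf : ContDiffOn ℝ ∞ f Ω)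
    (hflat : ∀ y ∈ Ω, ∀ x z v, curvatureEnd (conformalMetric f G) y x z v = 0)
    (hn : 3 ≤ Module.finrank ℝ E)
    (h : ∀ (u : ℝ → E) (ε : ℝ), 0 < ε → IsLocalGeodesicOn G Ω u (Set.Ioo (-ε) ε) →
      ∀ s ∈ Set.Ioo (-ε) ε, G (u s) (ricciOpOfSchouten f G (u s) (deriv u s)) (deriv u s) =
        G (u 0) (ricciOpOfSchouten f G (u 0) (deriv u 0)) (deriv u 0)) {z : E}
    (hy : y ∈ Ω) (hz : z ∈ Ω) :
    (ricciOpOfSchouten f G y : E →ₗ[ℝ] E).charpoly =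
      (ricciOpOfSchouten f G z : E →ₗ[ℝ] E).charpoly := by
  have : CompleteSpace E := FiniteDimensional.complete ℝ E
  have hS := hG.contDiffOn_sharp (hG.contDiffOn_schouten hf)
  have hρ : ContDiffOn ℝ ∞ (ricciOpOfSchouten f G) Ω :=
    ((contDiff_const_smul ((Module.finrank ℝ E : ℝ) - 2)).comp_contDiffOn hS).add
      (((traceL E).contDiff.comp_contDiffOn hS).smul
        (contDiffOn_const (c := ContinuousLinearMap.id ℝ E)))
  exact charpoly_eq_of_parallel (Γ := christoffel G) hG.isOpen hc (hρ.differentiableOn (by simp))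
    (fun y hy u => hG.fderiv_ricciOpOfSchouten hf hflat hy hn
      (hG.killing_of_geodesic hf hy h) u) hy hz

end IsMetricOn

end Geodesic

/-! ### Spectral theorem for a positive definite form -/

section Symmetric

variable {V : Type*} [AddCommGroup V] [Module ℝ V] [FiniteDimensional ℝ V]

/-- An operator which is symmetric with respect to a positive definite symmetric bilinear form is
diagonalizable. -/
theorem exists_eigenvalues_of_symmetric (b : V →ₗ[ℝ] V →ₗ[ℝ] ℝ) (hb : ∀ v w, b v w = b w v)
    (hpos : ∀ v, v ≠ 0 → 0 < b v v) (A : V →ₗ[ℝ] V) (hA : ∀ v w, b (A v) w = b v (A w)) :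
    A.charpoly.Splits ∧ ∀ {n : ℕ}, Module.finrank ℝ V = n →
      ∃ r : Fin n → ℝ, eigenvalues A = Multiset.map r Finset.univ.val := by
  let c : InnerProductSpace.Core ℝ V :=
    { inner := fun v w => b v w
      conj_inner_symm := fun v w => by simp [hb v w]
      re_inner_nonneg := fun v => by
        rcases eq_or_ne v 0 with rfl | h
        · simp
        · exact (hpos v h).le
      add_left := fun u v w => by simp
      smul_left := fun v w r => by simp
      definite := fun v h => by
        by_contra h0
        exact (hpos v h0).ne' h }
  let _ : NormedAddCommGroup V := c.toNormedAddCommGroup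
  let _ : InnerProductSpace ℝ V := InnerProductSpace.ofCore c.toCore
  have hS : A.IsSymmetric := hA
  exact ⟨hS.splits_charpoly, fun hn => ⟨hS.eigenvalues hn,
    by simpa [eigenvalues] using hS.roots_charpoly_eq_eigenvalues hn⟩⟩

end Symmetric

/-! ### Changes of coordinates and the metric in a chart -/

section Charts

variable {n : ℕ} {M : Type*} [TopologicalSpace M] [ChartedSpace (EuclideanSpace ℝ (Fin n)) M]

/-- The differential at `y` of the inverse of the chart around `p`, as an endomorphism of the model
space. -/
def symmDeriv (p : M) (y : EuclideanSpace ℝ (Fin n)) :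
    EuclideanSpace ℝ (Fin n) →L[ℝ] EuclideanSpace ℝ (Fin n) :=
  mfderiv (𝓡 n) (𝓡 n) (extChartAt (𝓡 n) p).symm y

/-- The value of a field of bilinear forms on two vectors of the model space. -/
def bilinAt (h : BilinField n M) (x : M) (v w : EuclideanSpace ℝ (Fin n)) : ℝ :=
  h x v w

theorem inChart_apply_bilinAt (h : BilinField n M) (p : M) (y v w : EuclideanSpace ℝ (Fin n)) :
    inChart h p y v w =
      bilinAt h ((extChartAt (𝓡 n) p).symm y) (symmDeriv p y v) (symmDeriv p y w) := rfl

/-- The change of coordinates from the chart around `p` to the chart around `q`. -/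
def transition (p q : M) : EuclideanSpace ℝ (Fin n) → EuclideanSpace ℝ (Fin n) :=
  extChartAt (𝓡 n) q ∘ (extChartAt (𝓡 n) p).symm

/-- The domain of the change of coordinates from the chart around `p` to the chart around `q`. -/
def transitionSource (p q : M) : Set (EuclideanSpace ℝ (Fin n)) :=
  (extChartAt (𝓡 n) p).target ∩ (extChartAt (𝓡 n) p).symm ⁻¹' (extChartAt (𝓡 n) q).source

theorem isOpen_transitionSource (p q : M) :
    IsOpen (transitionSource (n := n) p q) :=
  (continuousOn_extChartAt_symm p).isOpen_inter_preimage (isOpen_extChartAt_target p)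
    (isOpen_extChartAt_source q)

theorem symm_transition {p q : M} {y : EuclideanSpace ℝ (Fin n)} (hy : y ∈ transitionSource p q) :
    (extChartAt (𝓡 n) q).symm (transition p q y) = (extChartAt (𝓡 n) p).symm y :=
  (extChartAt (𝓡 n) q).left_inv hy.2

theorem mem_transitionSource_self {p : M} {y : EuclideanSpace ℝ (Fin n)}
    (hy : y ∈ (extChartAt (𝓡 n) p).target) :
    y ∈ transitionSource p ((extChartAt (𝓡 n) p).symm y) :=
  ⟨hy, mem_extChartAt_source _⟩

theorem mapsTo_transition (p q : M) :
    Set.MapsTo (transition (n := n) p q) (transitionSource p q) (extChartAt (𝓡 n) q).target :=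
  fun _ hy => (extChartAt (𝓡 n) q).map_source hy.2

variable [IsManifold (𝓡 n) ∞ M]

theorem mdifferentiableAt_symm {p : M} {y : EuclideanSpace ℝ (Fin n)}
    (hy : y ∈ (extChartAt (𝓡 n) p).target) :
    MDifferentiableAt (𝓡 n) (𝓡 n) (extChartAt (𝓡 n) p).symm y := by
  have : IsManifold (𝓡 n) 1 M := .of_le (n := ∞) (by simp)
  exact (mdifferentiableOn_extChartAt_symm y hy).mdifferentiableAt
    ((isOpen_extChartAt_target p).mem_nhds hy)

theorem contDiffOn_transition (p q : M) :
    ContDiffOn ℝ ∞ (transition (n := n) p q) (transitionSource p q) := by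
  have h := contDiffOn_ext_coord_change (I := 𝓡 n) (n := ∞) q p
  rw [PartialEquiv.trans_source, PartialEquiv.symm_source] at h
  exact h

theorem symmDeriv_comp_transition {p q : M} {y : EuclideanSpace ℝ (Fin n)}
    (hy : y ∈ transitionSource p q) :
    symmDeriv q (transition p q y) ∘L fderiv ℝ (transition p q) y = symmDeriv p y := by
  have h1 : MDifferentiableAt (𝓡 n) (𝓡 n) (transition p q) y :=
    ((contDiffOn_transition p q).contDiffAt
      ((isOpen_transitionSource p q).mem_nhds hy)).differentiableAt (by simp) |>.mdifferentiableAt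
  have h2 := mdifferentiableAt_symm (mapsTo_transition p q hy)
  have h3 := mfderiv_comp y h2 h1
  have h4 : mfderiv (𝓡 n) (𝓡 n) ((extChartAt (𝓡 n) q).symm ∘ transition p q) y =
      mfderiv (𝓡 n) (𝓡 n) (extChartAt (𝓡 n) p).symm y := by
    apply Filter.EventuallyEq.mfderiv_eq
    filter_upwards [(isOpen_transitionSource p q).mem_nhds hy] with z hz using symm_transition hz
  rw [mfderiv_eq_fderiv] at h3
  exact h3.symm.trans h4

theorem symmDeriv_isInvertible {p : M} {y : EuclideanSpace ℝ (Fin n)}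
    (hy : y ∈ (extChartAt (𝓡 n) p).target) : (symmDeriv p y).IsInvertible := by
  have : IsManifold (𝓡 n) 1 M := .of_le (n := ∞) (by simp)
  have h := isInvertible_mfderivWithin_extChartAt_symm (I := 𝓡 n) hy
  rw [ModelWithCorners.range_eq_univ, mfderivWithin_univ] at h
  exact h

theorem fderiv_transition_isInvertible {p q : M} {y : EuclideanSpace ℝ (Fin n)}
    (hy : y ∈ transitionSource p q) : (fderiv ℝ (transition p q) y).IsInvertible := by
  obtain ⟨e₁, h₁⟩ := symmDeriv_isInvertible (mapsTo_transition p q hy)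
  obtain ⟨e₂, h₂⟩ := symmDeriv_isInvertible hy.1
  refine ⟨e₂.trans e₁.symm, ?_⟩
  ext1 v
  have h := congrArg (fun L => e₁.symm (L v)) (symmDeriv_comp_transition hy)
  simp only [← h₁, ← h₂, ContinuousLinearMap.comp_apply, ContinuousLinearEquiv.coe_coe,
    ContinuousLinearEquiv.symm_apply_apply] at h
  simp [h]

theorem symmDeriv_self (p : M) :
    symmDeriv p (extChartAt (𝓡 n) p p) = ContinuousLinearMap.id ℝ _ := by
  have : IsManifold (𝓡 n) 1 M := .of_le (n := ∞) (by simp)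
  have h := mfderivWithin_range_extChartAt_symm (I := 𝓡 n) (x := p)
  rw [ModelWithCorners.range_eq_univ, mfderivWithin_univ] at h
  exact h

/-- The differential of the change of coordinates to the chart around the point itself. -/
theorem fderiv_transition_self {p : M} {y : EuclideanSpace ℝ (Fin n)}
    (hy : y ∈ (extChartAt (𝓡 n) p).target) :
    fderiv ℝ (transition p ((extChartAt (𝓡 n) p).symm y)) y = symmDeriv p y := by
  have h := symmDeriv_comp_transition (mem_transitionSource_self hy)
  have h2 : transition p ((extChartAt (𝓡 n) p).symm y) y =
    extChartAt (𝓡 n) ((extChartAt (𝓡 n) p).symm y) ((extChartAt (𝓡 n) p).symm y) := rfl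
  rw [h2, symmDeriv_self, ContinuousLinearMap.id_comp] at h
  exact h

/-- Both charts read the same form on `M`, so the pullback identity is the chain rule. -/
theorem isLocalIsometryOn_transition (h : BilinField n M) (p q : M) 
    {Ω₁ Ω₂ : Set (EuclideanSpace ℝ (Fin n))} (hΩ : Ω₁ ⊆ transitionSource p q)
    (hmaps : Set.MapsTo (transition p q) Ω₁ Ω₂) :
    IsLocalIsometryOn (inChart h p) (inChart h q) (transition p q) Ω₁ Ω₂ where
  contDiffOn := (contDiffOn_transition p q).mono hΩ
  mapsTo := hmaps
  isInvertible _ hy := fderiv_transition_isInvertible (hΩ hy)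
  pullback y hy v w := by
    rw [inChart_apply_bilinAt, inChart_apply_bilinAt, symm_transition (hΩ hy),
      ← symmDeriv_comp_transition (hΩ hy)]
    rfl

/-- In finite dimension it suffices to treat fixed `v` and `w`. Their images under the differential
of the inverse chart are smooth along it, and `g` pairs them smoothly. -/
theorem contDiffOn_inChart (g : Bundle.ContMDiffRiemannianMetric (𝓡 n) ∞
      (EuclideanSpace ℝ (Fin n)) (fun x : M => TangentSpace (𝓡 n) x)) (p : M) :
    ContDiffOn ℝ ∞ (inChart g.inner p) (extChartAt (𝓡 n) p).target := by
  have hsymm : ContMDiffOn (𝓡 n) (𝓡 n) ∞ (extChartAt (𝓡 n) p).symm (extChartAt (𝓡 n) p).target :=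
    contMDiffOn_extChartAt_symm p
  have : IsManifold (𝓡 n) 1 M := .of_le (n := ∞) (by simp)
  have hopen := isOpen_extChartAt_target (I := 𝓡 n) p
  have hvec : ∀ v : EuclideanSpace ℝ (Fin n),
      ContMDiffOn (𝓡 n) (𝓡 n).tangent ∞
        (fun y => Bundle.TotalSpace.mk' (EuclideanSpace ℝ (Fin n))
          (E := fun x : M => TangentSpace (𝓡 n) x) ((extChartAt (𝓡 n) p).symm y)
          (mfderiv (𝓡 n) (𝓡 n) (extChartAt (𝓡 n) p).symm y v)) (extChartAt (𝓡 n) p).target := by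
    intro v
    have h1 := hsymm.contMDiffOn_tangentMapWithin (m := ∞) (by simp) hopen.uniqueMDiffOn
    have h2 : ContMDiffOn (𝓡 n) (𝓡 n).tangent ∞
        (fun y : EuclideanSpace ℝ (Fin n) => Bundle.TotalSpace.mk' (EuclideanSpace ℝ (Fin n))
          (E := fun x : EuclideanSpace ℝ (Fin n) => TangentSpace (𝓡 n) x) y v)
        (extChartAt (𝓡 n) p).target := by
      exact contMDiffOn_vectorSpace_iff_contDiffOn.2 contDiffOn_const
    refine (h1.comp h2 fun y hy => hy).congr fun y hy => ?_
    simp only [Function.comp, tangentMapWithin]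
    rw [mfderivWithin_of_isOpen hopen hy]
  refine contDiffOn_clm_apply.2 fun v => contDiffOn_clm_apply.2 fun w => ?_
  rw [← contMDiffOn_iff_contDiffOn]
  intro y hy
  have h : ContMDiffWithinAt (𝓡 n) ((𝓡 n).prod 𝓘(ℝ)) ∞
      (fun y => Bundle.TotalSpace.mk' ℝ (E := Bundle.Trivial M ℝ) ((extChartAt (𝓡 n) p).symm y)
        (g.inner ((extChartAt (𝓡 n) p).symm y)
          (mfderiv (𝓡 n) (𝓡 n) (extChartAt (𝓡 n) p).symm y v)
          (mfderiv (𝓡 n) (𝓡 n) (extChartAt (𝓡 n) p).symm y w)))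
      (extChartAt (𝓡 n) p).target y := by
    apply ContMDiffWithinAt.clm_bundle_apply₂ (F₁ := EuclideanSpace ℝ (Fin n))
      (F₂ := EuclideanSpace ℝ (Fin n))
    · exact ContMDiffAt.comp_contMDiffWithinAt y g.contMDiff.contMDiffAt (hsymm y hy)
    · exact hvec v y hy
    · exact hvec w y hy
  simp only [Bundle.contMDiffWithinAt_totalSpace] at h
  exact h.2

end Charts

theorem isInvertible_of_posDef {E : Type*} [NormedAddCommGroup E] [NormedSpace ℝ E]
    [FiniteDimensional ℝ E] (B : E →L[ℝ] E →L[ℝ] ℝ) (hB : ∀ v, v ≠ 0 → 0 < B v v) :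
    B.IsInvertible := by
  have hinj : Function.Injective B.toLinearMap := by
    rw [← LinearMap.ker_eq_bot, LinearMap.ker_eq_bot']
    intro v hv
    by_contra h
    have h1 : B v v = 0 := congrArg (fun L : E →L[ℝ] ℝ => L v) hv
    exact (hB v h).ne' h1
  have hfr : Module.finrank ℝ E = Module.finrank ℝ (E →L[ℝ] ℝ) := by
    rw [← (LinearMap.toContinuousLinearMap (𝕜 := ℝ) (E := E) (F' := ℝ)).finrank_eq]
    exact Subspace.dual_finrank_eq.symm
  exact ⟨(B.toLinearMap.linearEquivOfInjective hinj hfr).toContinuousLinearEquiv, by ext; rfl⟩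

theorem IsMetricOn.mono {E : Type*} [NormedAddCommGroup E] [NormedSpace ℝ E]
    {G : E → E →L[ℝ] E →L[ℝ] ℝ} {Ω Ω' : Set E} (hG : IsMetricOn G Ω) (hΩ' : IsOpen Ω')
    (h : Ω' ⊆ Ω) : IsMetricOn G Ω' :=
  ⟨hΩ', hG.contDiffOn.mono h, fun y hy => hG.symm y (h hy), fun y hy => hG.isInvertible y (h hy)⟩

theorem eigenvalues_eq_of_intertwine {V W : Type*} [AddCommGroup V] [Module ℝ V]
    [FiniteDimensional ℝ V] [AddCommGroup W] [Module ℝ W] [FiniteDimensional ℝ W] (e : V ≃ₗ[ℝ] W)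
    (f : V →ₗ[ℝ] V) (f' : W →ₗ[ℝ] W) (h : ∀ v, e (f v) = f' (e v)) :
    eigenvalues f = eigenvalues f' := by
  have : e.conj f = f' := by
    ext w
    rw [LinearEquiv.conj_apply_apply, h, e.apply_symm_apply]
  rw [eigenvalues, eigenvalues, ← this, e.charpoly_conj]

/-! ### Transfer of curvature, Ricci tensor and geodesics between chart and manifold -/

section Charts

variable {n : ℕ} {M : Type*} [TopologicalSpace M] [ChartedSpace (EuclideanSpace ℝ (Fin n)) M]

/-- The part of the chart domain around `p` which corresponds to `U`. -/
def chartPreimage (p : M) (U : Set M) : Set (EuclideanSpace ℝ (Fin n)) :=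
  (extChartAt (𝓡 n) p).target ∩ (extChartAt (𝓡 n) p).symm ⁻¹' U

theorem isOpen_chartPreimage (p : M) {U : Set M} (hU : IsOpen U) :
    IsOpen (chartPreimage (n := n) p U) :=
  (continuousOn_extChartAt_symm p).isOpen_inter_preimage (isOpen_extChartAt_target p) hU

theorem inChart_conformal (f : M → ℝ) (h : BilinField n M) (p : M) :
    inChart (fun x => Real.exp (2 * f x) • h x) p =
      conformalMetric (f ∘ (extChartAt (𝓡 n) p).symm) (inChart h p) := rfl

variable [IsManifold (𝓡 n) ∞ M]

/-- In every chart, curvature is computed by the chart around the point itself. -/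
theorem symmDeriv_curvatureEnd (h : BilinField n M) {U : Set M} (hU : IsOpen U)
    (hM : ∀ p, IsMetricOn (inChart h p) (chartPreimage p U)) {p : M}
    {y : EuclideanSpace ℝ (Fin n)} (hy : y ∈ chartPreimage p U)
    (x z v : EuclideanSpace ℝ (Fin n)) :
    symmDeriv p y (curvatureEnd (inChart h p) y x z v) =
      curvatureEnd (inChart h ((extChartAt (𝓡 n) p).symm y))
        (extChartAt (𝓡 n) ((extChartAt (𝓡 n) p).symm y) ((extChartAt (𝓡 n) p).symm y))
        (symmDeriv p y x) (symmDeriv p y z) (symmDeriv p y v) := by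
  set q := (extChartAt (𝓡 n) p).symm y with hq
  have hopen : IsOpen (transitionSource (n := n) p q ∩ chartPreimage p U) :=
    (isOpen_transitionSource p q).inter (isOpen_chartPreimage p hU)
  have hiso : IsLocalIsometryOn (inChart h p) (inChart h q) (transition p q)
      (transitionSource p q ∩ chartPreimage p U) (chartPreimage q U) :=
    isLocalIsometryOn_transition h p q Set.inter_subset_left fun w hw =>
      ⟨mapsTo_transition p q hw.1, by
        rw [Set.mem_preimage, symm_transition hw.1]
        exact hw.2.2⟩
  have := hiso.fderiv_curvatureEnd ((hM p).mono hopen Set.inter_subset_right) (hM q)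
    ⟨mem_transitionSource_self hy.1, hy⟩ x z v
  rw [fderiv_transition_self hy.1] at this
  exact this

theorem ricciForm_eq (h : BilinField n M) {U : Set M} (hU : IsOpen U)
    (hM : ∀ p, IsMetricOn (inChart h p) (chartPreimage p U)) {p : M}
    {y : EuclideanSpace ℝ (Fin n)} (hy : y ∈ chartPreimage p U)
    (x z : EuclideanSpace ℝ (Fin n)) :
    ricciForm (inChart h p) y x z =
      ricciForm (inChart h ((extChartAt (𝓡 n) p).symm y))
        (extChartAt (𝓡 n) ((extChartAt (𝓡 n) p).symm y) ((extChartAt (𝓡 n) p).symm y))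
        (symmDeriv p y x) (symmDeriv p y z) := by
  obtain ⟨e, he⟩ := symmDeriv_isInvertible hy.1
  have h1 := symmDeriv_curvatureEnd h hU hM hy x z
  have h2 : e.toLinearEquiv.conj (curvatureEnd (inChart h p) y x z) =
      curvatureEnd (inChart h ((extChartAt (𝓡 n) p).symm y))
        (extChartAt (𝓡 n) ((extChartAt (𝓡 n) p).symm y) ((extChartAt (𝓡 n) p).symm y))
        (symmDeriv p y x) (symmDeriv p y z) := by
    ext1 w
    have h3 := h1 (e.symm w)
    rw [← he] at h3 ⊢
    simp only [ContinuousLinearEquiv.coe_coe, ContinuousLinearEquiv.apply_symm_apply] at h3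
    rw [LinearEquiv.conj_apply_apply]
    exact h3
  have h4 := LinearMap.trace_conj' (curvatureEnd (inChart h p) y x z) e.toLinearEquiv
  rw [h2] at h4
  exact h4.symm

/-- `IsFlatOn` tests each point only in its own chart; this carries flatness to all points of a
single chart. -/
theorem curvatureEnd_eq_zero_of_isFlatOn (h : BilinField n M) {U : Set M} (hU : IsOpen U)
    (hM : ∀ p, IsMetricOn (inChart h p) (chartPreimage p U)) (hflat : IsFlatOn h U) {p : M}
    {y : EuclideanSpace ℝ (Fin n)} (hy : y ∈ chartPreimage p U)
    (x z v : EuclideanSpace ℝ (Fin n)) : curvatureEnd (inChart h p) y x z v = 0 := by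
  apply (symmDeriv_isInvertible hy.1).injective
  rw [map_zero, symmDeriv_curvatureEnd h hU hM hy]
  exact hflat _ hy.2 _ _ _

variable (g : Bundle.ContMDiffRiemannianMetric (𝓡 n) ∞
      (EuclideanSpace ℝ (Fin n)) (fun x : M => TangentSpace (𝓡 n) x))

theorem inChart_pos {p : M} {y : EuclideanSpace ℝ (Fin n)}
    (hy : y ∈ (extChartAt (𝓡 n) p).target) (v : EuclideanSpace ℝ (Fin n)) (hv : v ≠ 0) :
    0 < inChart g.inner p y v v := by
  refine g.pos _ (symmDeriv p y v) fun h => hv ?_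
  exact (symmDeriv_isInvertible hy).injective (h.trans (map_zero _).symm)

theorem isMetricOn_inChart (p : M) :
    IsMetricOn (inChart g.inner p) (extChartAt (𝓡 n) p).target where
  isOpen := isOpen_extChartAt_target p
  contDiffOn := contDiffOn_inChart g p
  symm _ _ _ _ := g.symm _ _ _
  isInvertible _ hy := isInvertible_of_posDef _ (inChart_pos g hy)

theorem isMetricOn_inChart_univ (p : M) :
    IsMetricOn (inChart g.inner p) (chartPreimage p Set.univ) :=
  (isMetricOn_inChart g p).mono (isOpen_chartPreimage p isOpen_univ) Set.inter_subset_left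

theorem contDiffOn_comp_symm {f : M → ℝ} {U : Set M} (hf : ContMDiffOn (𝓡 n) 𝓘(ℝ, ℝ) ∞ f U)
    (p : M) : ContDiffOn ℝ ∞ (f ∘ (extChartAt (𝓡 n) p).symm) (chartPreimage p U) := by
  rw [← contMDiffOn_iff_contDiffOn]
  exact hf.comp ((contMDiffOn_extChartAt_symm p).mono Set.inter_subset_left) fun y hy => hy.2

theorem isMetricOn_conformal {f : M → ℝ} {U : Set M} (hU : IsOpen U)
    (hf : ContMDiffOn (𝓡 n) 𝓘(ℝ, ℝ) ∞ f U) (p : M) :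
    IsMetricOn (inChart (fun x => Real.exp (2 * f x) • g.inner x) p) (chartPreimage p U) := by
  rw [inChart_conformal]
  exact ((isMetricOn_inChart g p).mono (isOpen_chartPreimage p hU) Set.inter_subset_left).conformal
    (contDiffOn_comp_symm hf p)

variable {g} in
/-- A local geodesic in a chart yields a geodesic of the manifold. -/
theorem IsLocalGeodesicOn.isGeodesicOn {p : M} {Ω : Set (EuclideanSpace ℝ (Fin n))}
    {u : ℝ → EuclideanSpace ℝ (Fin n)} {J : Set ℝ}
    (hu : IsLocalGeodesicOn (inChart g.inner p) Ω u J) (hΩ : Ω ⊆ (extChartAt (𝓡 n) p).target)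
    (hJ : IsOpen J) : IsGeodesicOn g.inner ((extChartAt (𝓡 n) p).symm ∘ u) J := by
  refine ⟨(contMDiffOn_extChartAt_symm p).comp (contMDiffOn_iff_contDiffOn.2 hu.contDiffOn)
    fun t ht => hΩ (hu.mapsTo ht), fun t ht => ?_⟩
  set q := (extChartAt (𝓡 n) p).symm (u t) with hq
  have hyt : u t ∈ transitionSource p q := mem_transitionSource_self (hΩ (hu.mapsTo ht))
  have hopen := isOpen_transitionSource (n := n) p q
  have hsm := contDiffOn_transition (n := n) p q
  have hiso : IsLocalIsometryOn (inChart g.inner p) (inChart g.inner q) (transition p q)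
      (transitionSource p q) (extChartAt (𝓡 n) q).target :=
    isLocalIsometryOn_transition g.inner p q subset_rfl (mapsTo_transition p q)
  -- The inhomogeneous `D²ψ` term of the transformation law is exactly the extra term in the second
  -- derivative of `ψ ∘ u`.
  have key := hiso.fderiv_christoffel
    ((isMetricOn_inChart g p).mono hopen Set.inter_subset_left) (isMetricOn_inChart g q) hyt
    (deriv u t) (deriv u t)
  have hd : ∀ s ∈ J, u s ∈ transitionSource p q → HasDerivAt (transition p q ∘ u)
      (fderiv ℝ (transition p q) (u s) (deriv u s)) s := fun s hs hus =>
    (hasFDerivAt_of_contDiffOn hopen hsm hus).comp_hasDerivAt s (hu.hasDerivAt hJ hs)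
  have hev : ∀ᶠ s in 𝓝 t, u s ∈ transitionSource p q :=
    (hu.hasDerivAt hJ ht).continuousAt.eventually_mem (hopen.mem_nhds hyt)
  have hd2 : HasDerivAt (deriv (transition p q ∘ u)) _ t :=
    (((hasFDerivAt_of_contDiffOn hopen (contDiffOn_fderiv hopen hsm) hyt).comp_hasDerivAt t
      (hu.hasDerivAt hJ ht)).clm_apply (hu.hasDerivAt_deriv t ht)).congr_of_eventuallyEq (by
        filter_upwards [hev, hJ.mem_nhds ht] with s hs hsJ using (hd s hsJ hs).deriv)
  change deriv (deriv (transition p q ∘ u)) t + christoffel (inChart g.inner q)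
    (transition p q (u t)) (deriv (transition p q ∘ u) t) (deriv (transition p q ∘ u) t) = 0
  rw [hd2.deriv, (hd t ht hyt).deriv, map_neg, Function.comp_apply, key]
  abel

theorem velocity_symm_comp {p : M} {u : ℝ → EuclideanSpace ℝ (Fin n)} {t : ℝ}
    (hu : DifferentiableAt ℝ u t) (ht : u t ∈ (extChartAt (𝓡 n) p).target) :
    velocity ((extChartAt (𝓡 n) p).symm ∘ u) t = symmDeriv p (u t) (deriv u t) := by
  have h := mfderiv_comp t (mdifferentiableAt_symm ht) hu.mdifferentiableAt
  rw [mfderiv_eq_fderiv] at h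
  have h2 := congrArg (fun L => L (1 : ℝ)) h
  exact h2

theorem eigenvalues_jacobiOperator {p : M} {y : EuclideanSpace ℝ (Fin n)}
    (hy : y ∈ (extChartAt (𝓡 n) p).target) (x : EuclideanSpace ℝ (Fin n)) :
    eigenvalues (jacobiOperator g.inner ((extChartAt (𝓡 n) p).symm y) (symmDeriv p y x)) =
      eigenvalues (curvatureEnd (inChart g.inner p) y x x) := by
  obtain ⟨e, he⟩ := symmDeriv_isInvertible hy
  have h1 := symmDeriv_curvatureEnd g.inner isOpen_univ (isMetricOn_inChart_univ g)
    (p := p) (y := y) ⟨hy, trivial⟩ x x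
  refine (eigenvalues_eq_of_intertwine e.toLinearEquiv _ _ fun v => ?_).symm
  have h2 := h1 v
  rw [← he] at h2 ⊢
  exact h2

/-- By nondegeneracy, an operator representing the Ricci form in the chart is conjugate to the Ricci
operator through the differential of the inverse chart. -/
theorem eigenvalues_ricciOperator {p : M} {y : EuclideanSpace ℝ (Fin n)}
    (hy : y ∈ (extChartAt (𝓡 n) p).target)
    (ρ : EuclideanSpace ℝ (Fin n) →ₗ[ℝ] EuclideanSpace ℝ (Fin n))
    (hρ : ∀ x z, ricciForm (inChart g.inner p) y x z = inChart g.inner p y (ρ x) z) :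
    eigenvalues (ricciOperator g.inner ((extChartAt (𝓡 n) p).symm y)) = eigenvalues ρ := by
  obtain ⟨e, he⟩ := symmDeriv_isInvertible hy
  refine (eigenvalues_eq_of_intertwine e.toLinearEquiv _ _ fun v => ?_).symm
  apply (isInvertible_metric g ((extChartAt (𝓡 n) p).symm y)).injective
  ext w
  let w' : EuclideanSpace ℝ (Fin n) := w
  have hw : e (e.symm w') = w' := e.apply_symm_apply w'
  have h1 := ricciOperator_spec g ((extChartAt (𝓡 n) p).symm y) (e v) w
  have h2 := ricciForm_eq g.inner isOpen_univ (isMetricOn_inChart_univ g) (p := p) (y := y)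
    ⟨hy, trivial⟩ v (e.symm w')
  rw [hρ, inChart_apply_bilinAt, ← he] at h2
  simp only [ContinuousLinearEquiv.coe_coe, hw] at h2
  exact h2.trans h1.symm

end Charts

/-! ### Trace of the Jacobi operators -/

section LocallyConformallyFlat

variable {E : Type*} [NormedAddCommGroup E] [NormedSpace ℝ E] [FiniteDimensional ℝ E]
  {f : E → ℝ} {G : E → E →L[ℝ] E →L[ℝ] ℝ} {Ω : Set E} {y : E}

namespace IsMetricOn

theorem ricciOpOfSchouten_symm (hG : IsMetricOn G Ω) (hf : ContDiffOn ℝ ∞ f Ω) (hy : y ∈ Ω)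
    (v w : E) : G y (ricciOpOfSchouten f G y v) w = G y v (ricciOpOfSchouten f G y w) := by
  rw [hG.symm y hy v]
  simp [ricciOpOfSchouten, hG.apply_sharp hy, hG.schouten_comm hf hy v w, hG.symm y hy v w]

/-- The trace of the Jacobi operator is the sum of its eigenvalues. -/
theorem sum_eigenvalues_curvatureEnd (hG : IsMetricOn G Ω) (hf : ContDiffOn ℝ ∞ f Ω)
    (hflat : ∀ y ∈ Ω, ∀ x z v, curvatureEnd (conformalMetric f G) y x z v = 0) (hy : y ∈ Ω)
    (hpos : ∀ v, v ≠ 0 → 0 < G y v v) (x : E) :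
    (eigenvalues (curvatureEnd G y x x)).sum = G y (ricciOpOfSchouten f G y x) x := by
  have : CompleteSpace E := FiniteDimensional.complete ℝ E
  -- `eigenvalues` lists only real roots, so its sum is the trace only once the characteristic
  -- polynomial splits; symmetry of the Jacobi operator provides this.
  have hs := (exists_eigenvalues_of_symmetric
    ((ContinuousLinearMap.coeLM ℝ).comp (G y).toLinearMap) (hG.symm y hy) hpos
    (curvatureEnd G y x x) (fun v w => by
      change G y (curvatureEnd G y x x v) w = G y v (curvatureEnd G y x x w)
      rw [hG.symm y hy v, hG.curvatureEnd_eq_of_flat hf hflat hy,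
        hG.curvatureEnd_eq_of_flat hf hflat hy]
      simp only [map_add, map_sub, map_smul, add_apply, sub_apply, smul_apply, smul_eq_mul,
        hG.apply_inverse hy]
      rw [hG.schouten_comm hf hy w v, hG.schouten_comm hf hy v x, hG.schouten_comm hf hy w x,
        hG.symm y hy w v, hG.symm y hy v x, hG.symm y hy w x]
      ring)).1
  rw [eigenvalues, ← Module.End.trace_eq_sum_roots_charpoly_of_splits hs,
    ← hG.ricciForm_eq_of_flat hf hflat hy]
  rfl

end IsMetricOn

end LocallyConformallyFlat

/-! ### Local constancy of the Ricci eigenvalues on a 𝒞-space -/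

section CSpaces

variable {n : ℕ} {M : Type*} [TopologicalSpace M] [ChartedSpace (EuclideanSpace ℝ (Fin n)) M]
  [IsManifold (𝓡 n) ∞ M]
  (g : Bundle.ContMDiffRiemannianMetric (𝓡 n) ∞
      (EuclideanSpace ℝ (Fin n)) (fun x : M => TangentSpace (𝓡 n) x))

/-- In a conformally flat chart of a `𝒞`-space, `Ric(u', u')` is constant along geodesics. -/
theorem ricci_const_of_isCSpace (hC : IsCSpace g.inner) {p : M}
    {Ω : Set (EuclideanSpace ℝ (Fin n))} (hΩ : IsOpen Ω) (hΩt : Ω ⊆ (extChartAt (𝓡 n) p).target)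
    {f : EuclideanSpace ℝ (Fin n) → ℝ} (hf : ContDiffOn ℝ ∞ f Ω)
    (hflat : ∀ y ∈ Ω, ∀ x z v,
      curvatureEnd (conformalMetric f (inChart g.inner p)) y x z v = 0)
    {u : ℝ → EuclideanSpace ℝ (Fin n)} {J : Set ℝ} (hJ : IsOpen J) (hJ' : J.OrdConnected)
    (hu : IsLocalGeodesicOn (inChart g.inner p) Ω u J) {s t : ℝ} (hs : s ∈ J) (ht : t ∈ J) :
    inChart g.inner p (u s) (ricciOpOfSchouten f (inChart g.inner p) (u s) (deriv u s)) (deriv u s)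
      = inChart g.inner p (u t) (ricciOpOfSchouten f (inChart g.inner p) (u t) (deriv u t))
        (deriv u t) := by
  have hG := (isMetricOn_inChart g p).mono hΩ hΩt
  have key : ∀ r ∈ J, (eigenvalues (jacobiOperator g.inner (((extChartAt (𝓡 n) p).symm ∘ u) r)
      (velocity ((extChartAt (𝓡 n) p).symm ∘ u) r))).sum = inChart g.inner p (u r)
        (ricciOpOfSchouten f (inChart g.inner p) (u r) (deriv u r)) (deriv u r) := by
    intro r hr
    have hur := hu.mapsTo hr
    rw [velocity_symm_comp (hu.hasDerivAt hJ hr).differentiableAt (hΩt hur),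
      ← hG.sum_eigenvalues_curvatureEnd hf hflat hur (inChart_pos g (hΩt hur))]
    exact congrArg Multiset.sum (eigenvalues_jacobiOperator g (hΩt hur) (deriv u r))
  rw [← key s hs, ← key t ht, hC _ J hJ hJ' (hu.isGeodesicOn hΩt hJ) s hs t ht]

theorem eigenvalues_ricciOperator_locally_const (hn : 3 ≤ n)
    (hflat : IsLocallyConformallyFlat g.inner) (hC : IsCSpace g.inner) (p : M) :
    ∃ r : Fin n → ℝ, ∀ᶠ q in 𝓝 p,
      eigenvalues (ricciOperator g.inner q) = Multiset.map r Finset.univ.val := by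
  obtain ⟨U, hU, hpU, f, hf, hfl⟩ := hflat p
  set y₀ := extChartAt (𝓡 n) p p with hy₀
  have hy₀U : y₀ ∈ chartPreimage p U :=
    ⟨mem_extChartAt_target p, by rw [Set.mem_preimage, extChartAt_to_inv]; exact hpU⟩
  -- A ball is convex, hence preconnected, as the constancy of the characteristic polynomial
  -- requires.
  obtain ⟨ε, hε, hball⟩ := Metric.isOpen_iff.1 (isOpen_chartPreimage p hU) y₀ hy₀U
  set Ω := Metric.ball y₀ ε
  have hΩt : Ω ⊆ (extChartAt (𝓡 n) p).target := hball.trans Set.inter_subset_left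
  have hG := (isMetricOn_inChart g p).mono Metric.isOpen_ball hΩt
  have hf' := (contDiffOn_comp_symm hf p).mono hball
  set F := f ∘ (extChartAt (𝓡 n) p).symm
  have hflat' : ∀ y ∈ Ω, ∀ x z v,
      curvatureEnd (conformalMetric F (inChart g.inner p)) y x z v = 0 := fun y hy x z v =>
    curvatureEnd_eq_zero_of_isFlatOn _ hU (isMetricOn_conformal g hU hf) hfl (hball hy) x z v
  have hfr : Module.finrank ℝ (EuclideanSpace ℝ (Fin n)) = n := by simp
  have hy₀Ω : y₀ ∈ Ω := Metric.mem_ball_self hε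
  obtain ⟨r, hr⟩ := (exists_eigenvalues_of_symmetric
    ((ContinuousLinearMap.coeLM ℝ).comp (inChart g.inner p y₀).toLinearMap) (hG.symm y₀ hy₀Ω)
    (inChart_pos g (hΩt hy₀Ω)) (ricciOpOfSchouten F (inChart g.inner p) y₀).toLinearMap
    (hG.ricciOpOfSchouten_symm hf' hy₀Ω)).2 hfr
  refine ⟨r, ?_⟩
  filter_upwards [extChartAt_source_mem_nhds (I := 𝓡 n) p,
    (continuousAt_extChartAt (I := 𝓡 n) p).eventually_mem (Metric.ball_mem_nhds y₀ hε)]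
    with q hq hqΩ
  have h1 := eigenvalues_ricciOperator g (hΩt hqΩ)
    (ricciOpOfSchouten F (inChart g.inner p) (extChartAt (𝓡 n) p q)).toLinearMap
    (hG.ricciForm_eq_of_flat hf' hflat' hqΩ)
  rw [(extChartAt (𝓡 n) p).left_inv hq] at h1
  rw [h1, ← hr, eigenvalues, eigenvalues,
    hG.charpoly_ricciOpOfSchouten_eq (convex_ball y₀ ε).isPreconnected hf' hflat' (by rwa [hfr])
      (fun u δ hδ hu s hs => ricci_const_of_isCSpace g hC Metric.isOpen_ball hΩt hf' hflat'
        isOpen_Ioo Set.ordConnected_Ioo hu hs (by simp [hδ])) hqΩ hy₀Ω]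

end CSpaces

end CSpace

end

/-! ### From local to global constancy by connectedness -/

theorem theorem2p1 {n : ℕ} (hn : 3 ≤ n)
    {M : Type*} [TopologicalSpace M] [T2Space M] [ConnectedSpace M]
    [ChartedSpace (EuclideanSpace ℝ (Fin n)) M] [IsManifold (𝓡 n) ∞ M]
    (g : Bundle.ContMDiffRiemannianMetric (𝓡 n) ∞ (EuclideanSpace ℝ (Fin n))
      (fun x : M => TangentSpace (𝓡 n) x))
    (hflat : CSpace.IsLocallyConformallyFlat g.inner)
    (hC : CSpace.IsCSpace g.inner) :
    ∃ r : Fin n → ℝ, ∀ p : M,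
      CSpace.eigenvalues (CSpace.ricciOperator g.inner p) = Multiset.map r Finset.univ.val := by
  have hloc := CSpace.eigenvalues_ricciOperator_locally_const g hn hflat hC
  have hconst : IsLocallyConstant fun p => CSpace.eigenvalues (CSpace.ricciOperator g.inner p) := by
    refine (IsLocallyConstant.iff_eventually_eq _).2 fun p => ?_
    obtain ⟨r, hr⟩ := hloc p
    filter_upwards [hr] with q hq using hq.trans hr.self_of_nhds.symm
  obtain ⟨p₀⟩ := (inferInstance : Nonempty M)
  obtain ⟨r, hr⟩ := hloc p₀
  exact ⟨r, fun p =>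
    (hconst.apply_eq_of_isPreconnected isPreconnected_univ (Set.mem_univ p)
      (Set.mem_univ p₀)).trans hr.self_of_nhds⟩
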